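/- Theorem. Let $J\subseteq\mathbb R$ be open, let $s_0,\dots,s_3$ be $C^2$ functions on $J$ without zeros, let $n_0,\dots,n_5$ be $C^1$ functions on $J$, and let $\Lambda,v',w\in\mathbb R$. On $M=J\times\mathbb R^3$, with coordinates $(x^0,x^1,x^2,x^3)$, $x^0=t$, consider the non-symmetric metric $$\hat g=\begin{pmatrix} s_0(t)&n_0(t)&n_1(t)&n_2(t)\\-n_0(t)&s_1(t)&n_3(t)&n_4(t)\\-n_1(t)&-n_3(t)&s_2(t)&n_5(t)\\-n_2(t)&-n_4(t)&-n_5(t)&s_3(t)\end{pmatrix}.$$ For a non-symmetric metric with components $g_{ij}$ let $g_{\underline{ij}}$ be its symmetric part, $g=\det[g_{\underline{ij}}]$, $[g^{\underline{ij}}]=[g_{\underline{ij}}]^{-1}$; let $\Gamma^i_{jk}=\frac12g^{\underline{i\alpha}}(g_{j\alpha,k}-g_{jk,\alpha}+g_{\alpha k,j})$, $T^i_{jk}=\Gamma^i_{jk}-\Gamma^i_{kj}$ and $T_{ijk}=g_{\underline{i\alpha}}T^\alpha_{jk}$ (torsion); let $\Gamma^i_{\underline{jk}}$ be the Christoffel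 symbols of the symmetric part, $R^i_{jmn}=\Gamma^i_{\underline{jm},n}-\Gamma^i_{\underline{jn},m}+\Gamma^\alpha_{\underline{jm}}\Gamma^i_{\underline{\alpha n}}-\Gamma^\alpha_{\underline{jn}}\Gamma^i_{\underline{\alpha m}}$, $R_{ij}=R^\alpha_{ij\alpha}$ and $R=g^{\underline{\alpha\beta}}R_{\alpha\beta}$; put $|T|^2=g^{\underline{\gamma\delta}}g^{\underline{\epsilon\alpha}}g^{\underline{\beta\zeta}}T_{\epsilon\gamma\beta}T_{\alpha\delta\zeta}$ and define the matter term by $\mathcal L_M=-(v'+w)|T|^2$. Then the following hold. (1) For the metric $\hat g$ above, with $g=s_0s_1s_2s_3$, $$\mathcal L_M=-6(v'+w)\,g^{-1}\Big\{s_3(t)\,n_3'(t)^2+s_2(t)\,n_4'(t)^2+s_1(t)\,n_5'(t)^2\Big\}.$$ (2) The metric $\hat g$ corresponds to the Einstein–Hilbert action $S=\int d^4x\sqrt{|g|}\,(R-2\Lambda+\mathcal L_M)$ (in particular, for $\Lambda=0$, to $S=\int d^4x\sqrt{|g|}\,(R+\mathcal L_M)$) if and only if all of the equations of motion $$R_{ij}-\tfrac12Rg_{\underline{ij}}+\Lambda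 g_{\underline{ij}}=(v'+w)\big(3\tau_{ij}+2\mathcal W_{ij}-\tfrac12|T|^2g_{\underline{ij}}\big),\qquad 0\le i,j\le3,$$ hold on $M$, where $$\tau_{ij}=\frac{\delta g^{\underline{\gamma\delta}}}{\delta g^{\underline{ij}}}g^{\underline{\epsilon\alpha}}g^{\underline{\beta\zeta}}T_{\epsilon\gamma\beta}T_{\alpha\delta\zeta},\qquad \mathcal W_{ij}=g^{\underline{\gamma\delta}}g^{\underline{\epsilon\alpha}}g^{\underline{\beta\zeta}}T_{\epsilon\delta\zeta}\frac{\delta T_{\alpha\gamma\beta}}{\delta g^{\underline{ij}}}.$$ Here "corresponds to the action" means that the first variation of $S$ with respect to the symmetric part vanishes: for every compact $K\subset M$ and every smooth symmetric $h^{ij}$ with support in $K$, the integral over $K$ of $\sqrt{|g|}(R-2\Lambda+\mathcal L_M)$, computed for the metric with contravariant symmetric part $g^{\underline{ij}}+\varepsilon h^{ij}$ and unchanged covariant anti-symmetric part, has derivative $0$ with respect to $\varepsilon$ at $\varepsilon=0$. Likewise $\delta F/\delta g^{\underline{ij}}$ is the $\varepsilon$-derivative at $0$ of $F$ when $g^{\underline{kl}}$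 is replaced by $g^{\underline{kl}}+\frac{\varepsilon}{2}(\delta^k_i\delta^l_j+\delta^k_j\delta^l_i)$, the covariant anti-symmetric part being unchanged. -/

import Mathlib

open scoped ContDiff

noncomputable section

namespace GenRiem

/-- Points of the coordinate space, with coordinates `x 0 = t`, `x 1`, `x 2`, `x 3`. -/
abbrev Pt : Type := Fin 4 → ℝ

/-- Covariant components `g x i j` of a tensor field of type `(0,2)` (no symmetry required). -/
abbrev Field2 : Type := Pt → Matrix (Fin 4) (Fin 4) ℝ

/-- Partial derivative with respect to the `k`-th coordinate. -/
def pd (k : Fin 4) (f : Pt → ℝ) (x : Pt) : ℝ := fderiv ℝ f x (Pi.single k 1)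

/-- Symmetric part of a non-symmetric metric. -/
def symPart (g : Field2) : Field2 := fun x => (1 / 2 : ℝ) • (g x + (g x).transpose)

/-- Anti-symmetric part of a non-symmetric metric. -/
def antiPart (g : Field2) : Field2 := fun x => (1 / 2 : ℝ) • (g x - (g x).transpose)

/-- Contravariant components: the inverse of the matrix of the symmetric part. -/
def contra (g : Field2) : Field2 := fun x => (symPart g x)⁻¹

/-- Generalized Christoffel symbols of the second kind `Γ^i_{jk}` of the non-symmetric metric. -/
def genChristoffel (g : Field2) (i j k : Fin 4) (x : Pt) : ℝ :=
  (1 / 2) * ∑ a, contra g x i a *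
    (pd k (fun y => g y j a) x - pd a (fun y => g y j k) x + pd j (fun y => g y a k) x)

/-- Christoffel symbols of the associated space, that is, of the symmetric part of the metric. -/
def christoffel (g : Field2) (i j k : Fin 4) (x : Pt) : ℝ :=
  (1 / 2) * ∑ a, contra g x i a *
    (pd k (fun y => symPart g y j a) x - pd a (fun y => symPart g y j k) x
      + pd j (fun y => symPart g y a k) x)

/-- Curvature tensor `R^i_{jmn}` of the associated space. -/
def riemann (g : Field2) (i j m n : Fin 4) (x : Pt) : ℝ :=
  pd n (christoffel g i j m) x - pd m (christoffel g i j n) x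
    + ∑ a, christoffel g a j m x * christoffel g i a n x
    - ∑ a, christoffel g a j n x * christoffel g i a m x

/-- Ricci tensor `R_{ij} = R^α_{ijα}` of the associated space. -/
def ricci (g : Field2) (i j : Fin 4) (x : Pt) : ℝ := ∑ a, riemann g a i j a x

/-- Scalar curvature of the associated space. -/
def scalarCurv (g : Field2) (x : Pt) : ℝ := ∑ a, ∑ b, contra g x a b * ricci g a b x

/-- Torsion tensor `T^i_{jk}`: twice the anti-symmetric part of the generalized Christoffel
symbol. -/
def torsion (g : Field2) (i j k : Fin 4) (x : Pt) : ℝ :=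
  genChristoffel g i j k x - genChristoffel g i k j x

/-- Covariant torsion tensor `T_{ijk}`. -/
def torsionCov (g : Field2) (i j k : Fin 4) (x : Pt) : ℝ :=
  ∑ a, symPart g x i a * torsion g a j k x

/-- The full contraction `g^{γδ} g^{εα} g^{βζ} T_{εγβ} T_{αδζ}`; in the sum, `c, d, e, a, b, z`
are `γ, δ, ε, α, β, ζ`. -/
def torsionSq (g : Field2) (x : Pt) : ℝ :=
  ∑ c, ∑ d, ∑ e, ∑ a, ∑ b, ∑ z,
    contra g x c d * contra g x e a * contra g x b z
      * torsionCov g e c b x * torsionCov g a d z x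

/-- The matter term `L_M` with coefficients `v'`, `w`. -/
def matterL (v' w : ℝ) (g : Field2) (x : Pt) : ℝ := -(v' + w) * torsionSq g x

/-- The Einstein-Hilbert action with matter term `L_M` and cosmological constant `Λ`,
over a region `K`. -/
def action (Λ v' w : ℝ) (K : Set Pt) (g : Field2) : ℝ :=
  ∫ x in K, √|(symPart g x).det| * (scalarCurv g x - 2 * Λ + matterL v' w g x)

/-- The metric obtained by the variation `ε h^{ij}` of the contravariant components `g^{ij}` of
the symmetric part, the (covariant) anti-symmetric part being kept fixed. -/
def vary (g h : Field2) (ε : ℝ) : Field2 :=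
  fun x => (contra g x + ε • h x)⁻¹ + antiPart g x

/-- The metric `g` on the region `M` corresponds to the Einstein-Hilbert action: the first
variation of the action vanishes for every smooth symmetric variation of the contravariant
components which has compact support in `M`. (The action is taken over a compact set containing
that support, as the integral over `M` need not converge.) -/
def IsStationary (Λ v' w : ℝ) (M : Set Pt) (g : Field2) : Prop :=
  ∀ K : Set Pt, IsCompact K → K ⊆ M →
    ∀ h : Field2, (∀ i j, ContDiff ℝ ∞ (fun x => h x i j)) → (∀ x, (h x).IsSymm) →
      tsupport h ⊆ K →
        HasDerivAt (fun ε : ℝ => action Λ v' w K (vary g h ε)) 0 0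

/-- The symmetrized matrix unit: the direction in which the component `g^{ij} = g^{ji}` of a
symmetric matrix is varied. -/
def symUnit (i j : Fin 4) : Matrix (Fin 4) (Fin 4) ℝ :=
  (1 / 2 : ℝ) • (Matrix.single i j 1 + Matrix.single j i 1)

/-- Variational derivative `δF/δg^{ij}` at `x` of a quantity `F` which depends on the symmetric
part of the metric through its components at the point only. -/
def varDeriv (F : Field2 → Pt → ℝ) (g : Field2) (i j : Fin 4) (x : Pt) : ℝ :=
  deriv (fun ε : ℝ => F (vary g (fun _ => symUnit i j) ε) x) 0

/-- `τ_{ij} = (δg^{γδ}/δg^{ij}) g^{εα} g^{βζ} T_{εγβ} T_{αδζ}`. -/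
def tau (g : Field2) (i j : Fin 4) (x : Pt) : ℝ :=
  ∑ c, ∑ d, ∑ e, ∑ a, ∑ b, ∑ z,
    varDeriv (fun g' y => contra g' y c d) g i j x * contra g x e a * contra g x b z
      * torsionCov g e c b x * torsionCov g a d z x

/-- `W_{ij} = g^{γδ} g^{εα} g^{βζ} T_{εδζ} δT_{αγβ}/δg^{ij}`. -/
def calW (g : Field2) (i j : Fin 4) (x : Pt) : ℝ :=
  ∑ c, ∑ d, ∑ e, ∑ a, ∑ b, ∑ z,
    contra g x c d * contra g x e a * contra g x b z * torsionCov g e d z x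
      * varDeriv (fun g' => torsionCov g' a c b) g i j x

/-- The family of equations of motion, on the region `M`. -/
def EquationsOfMotion (Λ v' w : ℝ) (M : Set Pt) (g : Field2) : Prop :=
  ∀ x ∈ M, ∀ i j : Fin 4,
    ricci g i j x - 1 / 2 * scalarCurv g x * symPart g x i j + Λ * symPart g x i j =
      (v' + w) * (3 * tau g i j x + 2 * calW g i j x
        - 1 / 2 * torsionSq g x * symPart g x i j)

/-- The non-symmetric metric with diagonal symmetric part `s_i(t)` and anti-symmetric entries
`n_k(t)`. -/
def exMetric (s : Fin 4 → ℝ → ℝ) (n : Fin 6 → ℝ → ℝ) : Field2 := fun x =>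
  !![s 0 (x 0), n 0 (x 0), n 1 (x 0), n 2 (x 0);
     -n 0 (x 0), s 1 (x 0), n 3 (x 0), n 4 (x 0);
     -n 1 (x 0), -n 3 (x 0), s 2 (x 0), n 5 (x 0);
     -n 2 (x 0), -n 4 (x 0), -n 5 (x 0), s 3 (x 0)]

end GenRiem

end

open MeasureTheory Filter Topology
open scoped ContDiff

noncomputable section

namespace GenRiem

/-! ### Calculus along segments, and differentiation under the integral sign. -/

section Analysis

variable {E F : Type*} [NormedAddCommGroup E] [NormedSpace ℝ E]
  [NormedAddCommGroup F] [NormedSpace ℝ F]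

/-! The Lagrangian density is a smooth function of the 2-jet of the contravariant metric
$C=(g^{ij})$ and of the covariant torsion (`jetLagrangian`). Lowering the index of the torsion
cancels the inverse metric, so $T_{ijk}$ sees only the antisymmetric part (`torsionCov_eq`): it
stays fixed under the variation, and $\mathcal W_{ij}=0$. The variation is thus motion along a
segment in a finite-dimensional jet space, and over a compact set one may differentiate under the
integral (`hasDerivAt_setIntegral_line`).

The derivative of the density has three sources. The volume contributes
$-\frac12\sqrt{|g|}\,g_{ij}h^{ij}$, by the derivative of the determinant. The torsion term is cubic
in $C$; since $T_{ijk}$ is totally antisymmetric the three inverse metrics are interchangeable,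
which gives the factor $3$ in $3\tau_{ij}$. The curvature contributes $R_{ij}h^{ij}$ and
$g^{ij}\delta R_{ij}$; by the Palatini identity the latter, times $\sqrt{|g|}$, is the divergence of
$\sqrt{|g|}(g^{ij}\delta\Gamma^k_{ij}-g^{ik}\delta\Gamma^a_{ia})$, because $\sqrt{|g|}g^{ij}$ is
covariantly constant. That divergence integrates to zero since $h$ has compact support. What remains
is the pairing of $h$ with `eulerLagrange`, and the fundamental lemma of the calculus of variations
gives the equivalence (`IsAdmissible.isStationary_iff`). Symmetric $h$ test only the symmetric part
of `eulerLagrange`, so symmetry of the Ricci tensor is needed too.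

For $\hat g$, compatibility, symmetry of the Ricci tensor and the value of $|T|^2$ are computed
directly; everything depends on $t$ alone and the symmetric part is diagonal. -/

theorem hasDerivAt_add_smul (y z : E) (ε : ℝ) : HasDerivAt (fun ε : ℝ => y + ε • z) z ε := by
  simpa using ((hasDerivAt_id ε).smul_const z).const_add y

theorem hasDerivAt_comp_line {f : E → F} {y z : E} (hf : DifferentiableAt ℝ f y) :
    HasDerivAt (fun ε : ℝ => f (y + ε • z)) (fderiv ℝ f y z) 0 := by
  have h0 : DifferentiableAt ℝ f (y + (0 : ℝ) • z) := by simpa using hf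
  simpa [Function.comp_def] using
    h0.hasFDerivAt.comp_hasDerivAt (0 : ℝ) (hasDerivAt_add_smul y z 0)

/-- The derivative at `0` of the differential of `Φ` along a line of points and vectors. -/
theorem hasDerivAt_fderiv_line {Φ : E → ℝ} {y z p q : E} (hΦ : ContDiffAt ℝ 2 Φ y) :
    HasDerivAt (fun ε : ℝ => fderiv ℝ Φ (y + ε • z) (p + ε • q))
      (fderiv ℝ (fderiv ℝ Φ) y z p + fderiv ℝ Φ y q) 0 := by
  have h1 : DifferentiableAt ℝ (fderiv ℝ Φ) y :=
    (hΦ.fderiv_right (m := 1) (by norm_num)).differentiableAt (by norm_num)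
  simpa using (hasDerivAt_comp_line (z := z) h1).clm_apply (hasDerivAt_add_smul p q 0)

/-- Symmetry of the second derivative lets `z x` come before the derivative of `y`, so the value has
the form found in `hasDerivAt_fderiv_line`. Together the two say that varying commutes with
differentiating in the coordinates. -/
theorem fderiv_fderiv_comp_apply {Φ : E → ℝ} {y z : F → E} {x v : F}
    (hΦ : ContDiffAt ℝ 2 Φ (y x)) (hy : DifferentiableAt ℝ y x) (hz : DifferentiableAt ℝ z x) :
    fderiv ℝ (fun x' => fderiv ℝ Φ (y x') (z x')) x v =
      fderiv ℝ (fderiv ℝ Φ) (y x) (z x) (fderiv ℝ y x v)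
        + fderiv ℝ Φ (y x) (fderiv ℝ z x v) := by
  have h1 : DifferentiableAt ℝ (fderiv ℝ Φ) (y x) :=
    (hΦ.fderiv_right (m := 1) (by norm_num)).differentiableAt (by norm_num)
  have h2 : HasFDerivAt (fun x' => fderiv ℝ Φ (y x'))
      ((fderiv ℝ (fderiv ℝ Φ) (y x)).comp (fderiv ℝ y x)) x :=
    h1.hasFDerivAt.comp x hy.hasFDerivAt
  rw [(h2.clm_apply hz.hasFDerivAt).fderiv]
  have hs : IsSymmSndFDerivAt ℝ Φ (y x) := hΦ.isSymmSndFDerivAt (by simp)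
  simp [hs.eq (fderiv ℝ y x v) (z x), add_comm]

variable {X : Type*} [TopologicalSpace X]

/-- Compactness makes the range of `ε` uniform over `K`. -/
theorem eventually_line_mem {O : Set E} (hO : IsOpen O) {K : Set X} (hK : IsCompact K)
    {y z : X → E} (hy : ∀ x ∈ K, ContinuousAt y x) (hz : ∀ x ∈ K, ContinuousAt z x)
    (hyO : ∀ x ∈ K, y x ∈ O) :
    ∀ᶠ ε : ℝ in 𝓝 0, ∀ x ∈ K, y x + ε • z x ∈ O := by
  refine hK.eventually_forall_of_forall_eventually fun x hx => ?_
  have hc : ContinuousAt (fun q : ℝ × X => y q.2 + q.1 • z q.2) (0, x) :=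
    ((hy x hx).comp' continuousAt_snd).add (continuousAt_fst.smul ((hz x hx).comp' continuousAt_snd))
  exact hc.eventually (hO.mem_nhds (by simpa using hyO x hx))

/-- Differentiation under the integral sign over a compact set, for an integrand which is a
`C¹` function of a segment of continuous functions. -/
theorem hasDerivAt_setIntegral_line [MeasurableSpace X] [OpensMeasurableSpace X] [T2Space X]
    [SecondCountableTopologyEither X ℝ]
    {μ : Measure X} [IsFiniteMeasureOnCompacts μ]
    {O : Set E} (hO : IsOpen O) {Ψ : E → ℝ} (hΨ : ContDiffOn ℝ 1 Ψ O) {K : Set X}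
    (hK : IsCompact K)
    {y z : X → E} (hy : ∀ x ∈ K, ContinuousAt y x) (hz : ∀ x ∈ K, ContinuousAt z x)
    (hyO : ∀ x ∈ K, y x ∈ O) :
    HasDerivAt (fun ε : ℝ => ∫ x in K, Ψ (y x + ε • z x) ∂μ)
      (∫ x in K, fderiv ℝ Ψ (y x) (z x) ∂μ) 0 := by
  obtain ⟨δ, hδ, hball⟩ :=
    Metric.eventually_nhds_iff_ball.1 (eventually_line_mem hO hK hy hz hyO)
  set S : Set ℝ := Metric.closedBall 0 (δ / 2)
  have hSball : S ⊆ Metric.ball 0 δ := Metric.closedBall_subset_ball (by linarith)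
  have hyc : ContinuousOn y K := fun x hx => (hy x hx).continuousWithinAt
  have hzc : ContinuousOn z K := fun x hx => (hz x hx).continuousWithinAt
  have hline : ContinuousOn (fun q : ℝ × X => y q.2 + q.1 • z q.2) (S ×ˢ K) :=
    (hyc.comp continuousOn_snd fun q hq => hq.2).add
      (continuousOn_fst.smul (hzc.comp continuousOn_snd fun q hq => hq.2))
  have hfd : ContinuousOn (fderiv ℝ Ψ) O := hΨ.continuousOn_fderiv_of_isOpen hO le_rfl
  have hder : ContinuousOn (fun q : ℝ × X => fderiv ℝ Ψ (y q.2 + q.1 • z q.2) (z q.2))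
      (S ×ˢ K) :=
    (hfd.comp hline fun q hq => hball _ (hSball hq.1) _ hq.2).clm_apply
      (hzc.comp continuousOn_snd fun q hq => hq.2)
  -- The dominating function is a constant: the derivative is jointly continuous on the compact set
  -- `S ×ˢ K`.
  obtain ⟨B, hB⟩ := ((isCompact_closedBall (0 : ℝ) (δ / 2)).prod hK).exists_bound_of_continuousOn
    hder
  have hmeas : ∀ ε ∈ S, ContinuousOn (fun x => Ψ (y x + ε • z x)) K := fun ε hε =>
    hΨ.continuousOn.comp (hyc.add (hzc.const_smul ε)) fun x hx => hball _ (hSball hε) _ hx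
  have hS : S ∈ 𝓝 (0 : ℝ) := Metric.closedBall_mem_nhds _ (by linarith)
  have h0 : (0 : ℝ) ∈ S := mem_of_mem_nhds hS
  have key := hasDerivAt_integral_of_dominated_loc_of_deriv_le (μ := μ.restrict K)
    (F := fun (ε : ℝ) x => Ψ (y x + ε • z x))
    (F' := fun (ε : ℝ) x => fderiv ℝ Ψ (y x + ε • z x) (z x)) (bound := fun _ => B) (x₀ := 0) hS
    (by filter_upwards [hS] with ε hε
        exact (hmeas ε hε).aestronglyMeasurable hK.measurableSet)
    ((hmeas 0 h0).integrableOn_compact hK)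
    (by
      have : ContinuousOn (fun x => fderiv ℝ Ψ (y x + (0 : ℝ) • z x) (z x)) K :=
        hder.comp (f := fun x => ((0 : ℝ), x)) (by fun_prop) fun x hx => ⟨h0, hx⟩
      exact this.aestronglyMeasurable hK.measurableSet)
    (by
      filter_upwards [ae_restrict_mem hK.measurableSet] with x hx ε hε
      exact hB (ε, x) ⟨hε, hx⟩)
    ((continuousOn_const).integrableOn_compact hK)
    (by
      filter_upwards [ae_restrict_mem hK.measurableSet] with x hx ε hε
      have hd : DifferentiableAt ℝ Ψ (y x + ε • z x) :=
        (hΨ.contDiffAt (hO.mem_nhds (hball _ (hSball hε) _ hx))).differentiableAt (by norm_num)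
      exact hd.hasFDerivAt.comp_hasDerivAt ε (hasDerivAt_add_smul (y x) (z x) ε))
  simpa using key.2

end Analysis

/-! ### Partial derivatives on the coordinate space. -/

theorem contDiffAt_pd {f : Pt → ℝ} {x : Pt} {m n : ℕ∞ω} (hf : ContDiffAt ℝ n f x)
    (hmn : m + 1 ≤ n) (k : Fin 4) : ContDiffAt ℝ m (pd k f) x :=
  (hf.fderiv_right hmn).clm_apply contDiffAt_const

theorem pd_congr {f g : Pt → ℝ} {x : Pt} (h : f =ᶠ[𝓝 x] g) (k : Fin 4) : pd k f x = pd k g x := by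
  rw [pd, pd, h.fderiv_eq]

theorem pd_add {f g : Pt → ℝ} {x : Pt} (hf : DifferentiableAt ℝ f x) (hg : DifferentiableAt ℝ g x)
    (k : Fin 4) : pd k (fun y => f y + g y) x = pd k f x + pd k g x := by
  simp [pd, fderiv_fun_add hf hg]

theorem pd_sub {f g : Pt → ℝ} {x : Pt} (hf : DifferentiableAt ℝ f x) (hg : DifferentiableAt ℝ g x)
    (k : Fin 4) : pd k (fun y => f y - g y) x = pd k f x - pd k g x := by
  simp [pd, fderiv_fun_sub hf hg]

theorem pd_mul {f g : Pt → ℝ} {x : Pt} (hf : DifferentiableAt ℝ f x) (hg : DifferentiableAt ℝ g x)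
    (k : Fin 4) : pd k (fun y => f y * g y) x = pd k f x * g x + f x * pd k g x := by
  simp [pd, fderiv_fun_mul hf hg]; ring

theorem pd_const_mul {f : Pt → ℝ} {x : Pt} (hf : DifferentiableAt ℝ f x) (c : ℝ)
    (k : Fin 4) : pd k (fun y => c * f y) x = c * pd k f x := by
  simp [pd, fderiv_const_mul hf]

theorem pd_sum {ι : Type*} (u : Finset ι) {f : ι → Pt → ℝ} {x : Pt}
    (hf : ∀ i ∈ u, DifferentiableAt ℝ (f i) x) (k : Fin 4) :
    pd k (fun y => ∑ i ∈ u, f i y) x = ∑ i ∈ u, pd k (f i) x := by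
  simp [pd, fderiv_fun_sum hf]

/-- Partial derivatives of a function of the coordinate `t` alone. -/
theorem pd_comp_time {f : ℝ → ℝ} {x : Pt} {f' : ℝ} (hf : HasDerivAt f f' (x 0)) (k : Fin 4) :
    pd k (fun y => f (y 0)) x = if k = 0 then f' else 0 := by
  have h0 : HasFDerivAt (fun y : Pt => y 0) (ContinuousLinearMap.proj (R := ℝ) (0 : Fin 4)) x :=
    (ContinuousLinearMap.proj (R := ℝ) (φ := fun _ : Fin 4 => ℝ) (0 : Fin 4)).hasFDerivAt
  have h := hf.comp_hasFDerivAt x h0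
  rw [pd]
  erw [h.fderiv]
  by_cases hk : k = 0
  · subst hk; simp
  · simp [hk, Ne.symm hk]

/-- A partial derivative of a `C¹` function with compact support has integral zero. -/
theorem integral_pd_eq_zero {f : Pt → ℝ} (hf : ContDiff ℝ 1 f) (hc : HasCompactSupport f)
    (k : Fin 4) : ∫ x, pd k f x = 0 := by
  have hcont : Continuous (fun x => fderiv ℝ f x (Pi.single k 1)) :=
    (hf.continuous_fderiv one_ne_zero).clm_apply continuous_const
  have hcs : HasCompactSupport (fun x => fderiv ℝ f x (Pi.single k 1)) :=
    hc.fderiv_apply ℝ _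
  -- Integration by parts against the constant function `1`.
  have h := integral_bilinear_fderiv_right_eq_neg_left_of_integrable (μ := volume)
    (f := fun _ : Pt => (1 : ℝ)) (g := f) (v := Pi.single k 1)
    (B := ContinuousLinearMap.lsmul ℝ ℝ) (by simp)
    (by simpa using hcont.integrable_of_hasCompactSupport hcs)
    (by simpa using hf.continuous.integrable_of_hasCompactSupport hc)
    (by simp) (fun x _ => hf.differentiable (by norm_num) x)
  simpa [pd] using h

/-! ### Connection, curvature and Lagrangian as smooth functions of jets. -/

/-- Arrays with two indices, with the supremum norm. -/
abbrev Arr2 : Type := Fin 4 → Fin 4 → ℝ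

/-- Arrays with three indices. -/
abbrev Arr3 : Type := Fin 4 → Arr2

/-- Arrays with four indices. -/
abbrev Arr4 : Type := Fin 4 → Arr3

/-- Covariant components, as functions of the contravariant ones. -/
def lower (i j : Fin 4) (C : Arr2) : ℝ := (Matrix.of C)⁻¹ i j

/-- The invertible matrices. -/
def nondeg : Set Arr2 := {C | (Matrix.of C).det ≠ 0}

theorem contDiff_matrix_det {E : Type*} [NormedAddCommGroup E] [NormedSpace ℝ E]
    {A : E → Matrix (Fin 4) (Fin 4) ℝ} {m : ℕ∞ω} (hA : ∀ i j, ContDiff ℝ m fun e => A e i j) :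
    ContDiff ℝ m fun e => (A e).det := by
  simp only [Matrix.det_apply]
  exact ContDiff.sum fun σ _ => (contDiff_prod fun i _ => hA _ _).const_smul _

theorem contDiff_det : ContDiff ℝ ∞ fun C : Arr2 => (Matrix.of C).det :=
  contDiff_matrix_det fun i j => contDiff_apply_apply ℝ ℝ i j

theorem isOpen_nondeg : IsOpen nondeg := isOpen_ne_fun contDiff_det.continuous continuous_const

/-- Cramer's rule: an entry of the inverse is a polynomial divided by the determinant. -/
theorem contDiffAt_lower {C : Arr2} (hC : C ∈ nondeg) (i j : Fin 4) :
    ContDiffAt ℝ ∞ (lower i j) C := by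
  have h : lower i j = fun C : Arr2 =>
      ((Matrix.of C).det)⁻¹ * ((Matrix.of C).updateRow j (Pi.single i 1)).det := by
    funext C
    simp [lower, Matrix.inv_def, Matrix.adjugate_apply]
  rw [h]
  refine (contDiff_det.contDiffAt.inv hC).mul (ContDiff.contDiffAt ?_)
  refine contDiff_matrix_det fun a b => ?_
  by_cases ha : a = j
  · subst ha; simpa using contDiff_const
  · simpa [Matrix.updateRow_ne ha] using contDiff_apply_apply ℝ ℝ a b

/-- Christoffel symbols as functions of the contravariant components and of their first
partial derivatives. -/
def jetChristoffel (i j k : Fin 4) (p : Arr2 × Arr3) : ℝ :=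
  (1 / 2) * ∑ a, p.1 i a * (fderiv ℝ (lower j a) p.1 (p.2 k) - fderiv ℝ (lower j k) p.1 (p.2 a)
    + fderiv ℝ (lower a k) p.1 (p.2 j))

theorem contDiffAt_jetChristoffel {p : Arr2 × Arr3} (hp : p.1 ∈ nondeg) (i j k : Fin 4) :
    ContDiffAt ℝ ∞ (jetChristoffel i j k) p := by
  have h1 : ∀ a b c, ContDiffAt ℝ ∞ (fun q : Arr2 × Arr3 => fderiv ℝ (lower a b) q.1 (q.2 c)) p :=
    fun a b c =>
      (((contDiffAt_lower hp a b).fderiv_right (m := ∞) (by simp)).comp p contDiffAt_fst).clm_apply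
        ((contDiff_apply ℝ Arr2 c).contDiffAt.comp p contDiffAt_snd)
  have h2 : ∀ a b, ContDiffAt ℝ ∞ (fun q : Arr2 × Arr3 => q.1 a b) p := fun a b =>
    (contDiff_apply_apply ℝ ℝ a b).contDiffAt.comp p contDiffAt_fst
  exact contDiffAt_const.mul (ContDiffAt.sum fun a _ =>
    (h2 i a).mul (((h1 _ _ _).sub (h1 _ _ _)).add (h1 _ _ _)))

/-- First partial derivatives of Christoffel symbols in terms of the 2-jet. -/
def jetChristoffelDeriv (l i j k : Fin 4) (p : Arr2 × Arr3 × Arr4) : ℝ :=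
  fderiv ℝ (jetChristoffel i j k) (p.1, p.2.1) (p.2.1 l, p.2.2 l)

/-- Ricci tensor in terms of the 2-jet of the contravariant components. -/
def jetRicci (i j : Fin 4) (p : Arr2 × Arr3 × Arr4) : ℝ :=
  ∑ a, (jetChristoffelDeriv a a i j p - jetChristoffelDeriv j a i a p
    + ∑ b, jetChristoffel b i j (p.1, p.2.1) * jetChristoffel a b a (p.1, p.2.1)
    - ∑ b, jetChristoffel b i a (p.1, p.2.1) * jetChristoffel a b j (p.1, p.2.1))

theorem contDiffAt_jetRicci {p : Arr2 × Arr3 × Arr4} (hp : p.1 ∈ nondeg) (i j : Fin 4) :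
    ContDiffAt ℝ ∞ (jetRicci i j) p := by
  have h0 : ContDiffAt ℝ ∞ (fun q : Arr2 × Arr3 × Arr4 => (q.1, q.2.1)) p := by fun_prop
  have h1 : ∀ i j k, ContDiffAt ℝ ∞
      (fun q : Arr2 × Arr3 × Arr4 => jetChristoffel i j k (q.1, q.2.1)) p := fun i j k =>
    ContDiffAt.comp (g := jetChristoffel i j k) (f := fun q : Arr2 × Arr3 × Arr4 => (q.1, q.2.1)) p
      (contDiffAt_jetChristoffel (p := (p.1, p.2.1)) hp i j k) h0
  have h2 : ∀ l i j k, ContDiffAt ℝ ∞ (jetChristoffelDeriv l i j k) p := fun l i j k => by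
    refine ContDiffAt.clm_apply (ContDiffAt.comp p
      ((contDiffAt_jetChristoffel (p := (p.1, p.2.1)) hp i j k).fderiv_right (m := ∞)
        (by simp)) h0) ?_
    fun_prop
  exact ContDiffAt.sum fun a _ => (((h2 _ _ _ _).sub (h2 _ _ _ _)).add
    (ContDiffAt.sum fun b _ => (h1 _ _ _).mul (h1 _ _ _))).sub
    (ContDiffAt.sum fun b _ => (h1 _ _ _).mul (h1 _ _ _))

/-- The contraction `C^{cd} C^{ea} C^{bz} T_{ecb} T_{adz}`. -/
def tripleSq (C : Arr2) (T : Arr3) : ℝ :=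
  ∑ c, ∑ d, ∑ e, ∑ a, ∑ b, ∑ z, C c d * C e a * C b z * T e c b * T a d z

/-- The Lagrangian density as a function of the 2-jet of the contravariant components of the
metric and of the torsion. -/
def jetLagrangian (Λ κ : ℝ) (p : (Arr2 × Arr3 × Arr4) × Arr3) : ℝ :=
  √|((Matrix.of p.1.1)⁻¹).det| * ((∑ a, ∑ b, p.1.1 a b * jetRicci a b p.1) - 2 * Λ
    + -κ * tripleSq p.1.1 p.2)

theorem contDiff_tripleSq : ContDiff ℝ ∞ fun q : Arr2 × Arr3 => tripleSq q.1 q.2 := by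
  unfold tripleSq
  fun_prop

theorem contDiffAt_sqrt_abs {a : ℝ} (ha : a ≠ 0) : ContDiffAt ℝ ∞ (fun a => √|a|) a :=
  (contDiffAt_abs ha).sqrt (abs_ne_zero.2 ha)

theorem contDiffAt_volume {C : Arr2} (hC : C ∈ nondeg) :
    ContDiffAt ℝ ∞ (fun C : Arr2 => √|((Matrix.of C)⁻¹).det|) C := by
  simp only [Matrix.det_nonsing_inv, Ring.inverse_eq_inv']
  exact ContDiffAt.comp (g := fun a : ℝ => √|a|) (f := fun C : Arr2 => ((Matrix.of C).det)⁻¹) C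
    (contDiffAt_sqrt_abs (inv_ne_zero hC)) (contDiff_det.contDiffAt.inv hC)

theorem contDiffAt_jetLagrangian (Λ κ : ℝ) {p : (Arr2 × Arr3 × Arr4) × Arr3}
    (hp : p.1.1 ∈ nondeg) : ContDiffAt ℝ ∞ (jetLagrangian Λ κ) p := by
  have h0 : ContDiffAt ℝ ∞ (fun q : (Arr2 × Arr3 × Arr4) × Arr3 => q.1.1) p := by fun_prop
  have h1 : ∀ a b, ContDiffAt ℝ ∞ (fun q : (Arr2 × Arr3 × Arr4) × Arr3 => q.1.1 a b) p := by
    intro a b; fun_prop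
  have h2 : ∀ a b, ContDiffAt ℝ ∞
      (fun q : (Arr2 × Arr3 × Arr4) × Arr3 => jetRicci a b q.1) p := fun a b =>
    ContDiffAt.comp (g := jetRicci a b) (f := Prod.fst) p (contDiffAt_jetRicci hp a b)
      contDiffAt_fst
  have h3 : ContDiffAt ℝ ∞ (fun q : (Arr2 × Arr3 × Arr4) × Arr3 => tripleSq q.1.1 q.2) p :=
    ContDiffAt.comp (g := fun q : Arr2 × Arr3 => tripleSq q.1 q.2)
      (f := fun q : (Arr2 × Arr3 × Arr4) × Arr3 => (q.1.1, q.2)) p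
      contDiff_tripleSq.contDiffAt (h0.prodMk contDiffAt_snd)
  have h4 : ContDiffAt ℝ ∞ (fun q : (Arr2 × Arr3 × Arr4) × Arr3 =>
      ∑ a, ∑ b, q.1.1 a b * jetRicci a b q.1) p :=
    ContDiffAt.sum fun a _ => ContDiffAt.sum fun b _ => (h1 a b).mul (h2 a b)
  have h5 : ContDiffAt ℝ ∞ (fun q : (Arr2 × Arr3 × Arr4) × Arr3 =>
      √|((Matrix.of q.1.1)⁻¹).det|) p :=
    ContDiffAt.comp (g := fun C : Arr2 => √|((Matrix.of C)⁻¹).det|) p (contDiffAt_volume hp) h0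
  exact h5.mul ((h4.sub contDiffAt_const).add (contDiffAt_const.mul h3))

/-! ### Jets of fields -/

/-- First partial derivatives of a field of arrays. -/
def partials (C : Pt → Arr2) (x : Pt) : Arr3 := fun k i j => pd k (fun y => C y i j) x

/-- Second partial derivatives of a field of arrays. -/
def partials₂ (C : Pt → Arr2) (x : Pt) : Arr4 :=
  fun l k i j => pd l (fun y => partials C y k i j) x

/-- The 1-jet of a field of arrays. -/
def jet₁ (C : Pt → Arr2) (x : Pt) : Arr2 × Arr3 := (C x, partials C x)

/-- The 2-jet of a field of arrays. -/
def jet₂ (C : Pt → Arr2) (x : Pt) : Arr2 × Arr3 × Arr4 := (C x, partials C x, partials₂ C x)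

theorem fderiv_arr2_apply {C : Pt → Arr2} {x : Pt} (hC : DifferentiableAt ℝ C x) (k : Fin 4) :
    fderiv ℝ C x (Pi.single k 1) = partials C x k := by
  have h1 : ∀ i, DifferentiableAt ℝ (fun y => C y i) x := differentiableAt_pi.1 hC
  funext i j
  rw [partials, pd, fderiv_pi (φ := fun i y => C y i) h1,
    ContinuousLinearMap.pi_apply, fderiv_pi (φ := fun j y => C y i j)
      (differentiableAt_pi.1 (h1 i)), ContinuousLinearMap.pi_apply]

theorem contDiffAt_partials {C : Pt → Arr2} {x : Pt} {m n : ℕ∞ω} (hC : ContDiffAt ℝ n C x)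
    (hmn : m + 1 ≤ n) : ContDiffAt ℝ m (partials C) x :=
  contDiffAt_pi.2 fun k => contDiffAt_pi.2 fun i => contDiffAt_pi.2 fun j =>
    contDiffAt_pd (contDiffAt_pi.1 (contDiffAt_pi.1 hC i) j) hmn k

theorem contDiffAt_partials₂ {C : Pt → Arr2} {x : Pt} {m n : ℕ∞ω} (hC : ContDiffAt ℝ n C x)
    (hmn : m + 1 + 1 ≤ n) : ContDiffAt ℝ m (partials₂ C) x :=
  contDiffAt_pi.2 fun l => contDiffAt_pi.2 fun k => contDiffAt_pi.2 fun i => contDiffAt_pi.2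
    fun j => contDiffAt_pd (contDiffAt_pi.1 (contDiffAt_pi.1 (contDiffAt_pi.1
      (contDiffAt_partials hC hmn) k) i) j) le_rfl l

theorem contDiffAt_jet₁ {C : Pt → Arr2} {x : Pt} (hC : ContDiffAt ℝ 2 C x) :
    ContDiffAt ℝ 1 (jet₁ C) x :=
  (hC.of_le (by norm_num)).prodMk (contDiffAt_partials hC (by norm_num))

theorem continuousAt_jet₂ {C : Pt → Arr2} {x : Pt} (hC : ContDiffAt ℝ 2 C x) :
    ContinuousAt (jet₂ C) x :=
  hC.continuousAt.prodMk ((contDiffAt_partials (m := 1) hC (by norm_num)).continuousAt.prodMk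
    (contDiffAt_partials₂ (m := 0) hC (by norm_num)).continuousAt)

theorem fderiv_jet₁_apply {C : Pt → Arr2} {x : Pt} (hC : ContDiffAt ℝ 2 C x) (l : Fin 4) :
    fderiv ℝ (jet₁ C) x (Pi.single l 1) = (partials C x l, partials₂ C x l) := by
  have h1 : DifferentiableAt ℝ C x := hC.differentiableAt (by norm_num)
  have h2 : DifferentiableAt ℝ (partials C) x :=
    (contDiffAt_partials (m := 1) hC (by norm_num)).differentiableAt (by norm_num)
  have h : HasFDerivAt (jet₁ C) ((fderiv ℝ C x).prod (fderiv ℝ (partials C) x)) x :=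
    h1.hasFDerivAt.prodMk h2.hasFDerivAt
  rw [h.fderiv, ContinuousLinearMap.prod_apply, fderiv_arr2_apply h1]
  congr 1
  have h3 : ∀ i, DifferentiableAt ℝ (fun y => partials C y i) x := differentiableAt_pi.1 h2
  funext k
  rw [fderiv_pi (φ := fun i y => partials C y i) h3, ContinuousLinearMap.pi_apply,
    fderiv_arr2_apply (h3 k)]
  rfl

theorem partials_congr {C C' : Pt → Arr2} {x : Pt} (h : C =ᶠ[𝓝 x] C') :
    partials C =ᶠ[𝓝 x] partials C' := by
  filter_upwards [h.eventuallyEq_nhds] with y hy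
  funext k i j
  exact pd_congr (hy.fun_comp fun A => A i j) k

theorem jet₂_congr {C C' : Pt → Arr2} {x : Pt} (h : C =ᶠ[𝓝 x] C') : jet₂ C x = jet₂ C' x := by
  have h1 := partials_congr h
  rw [jet₂, jet₂, h.eq_of_nhds, h1.eq_of_nhds]
  congr 2
  funext l k i j
  exact pd_congr (h1.fun_comp fun A => A k i j) l

theorem partials_add_smul {A B : Pt → Arr2} {x : Pt} (hA : DifferentiableAt ℝ A x)
    (hB : DifferentiableAt ℝ B x) (ε : ℝ) :
    partials (fun y => A y + ε • B y) x = partials A x + ε • partials B x := by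
  funext k i j
  have h1 : DifferentiableAt ℝ (fun y => A y i j) x :=
    differentiableAt_pi.1 (differentiableAt_pi.1 hA i) j
  have h2 : DifferentiableAt ℝ (fun y => B y i j) x :=
    differentiableAt_pi.1 (differentiableAt_pi.1 hB i) j
  have := pd_add h1 (h2.const_mul ε) k
  rw [pd_const_mul h2] at this
  exact this

theorem jet₂_add_smul {A B : Pt → Arr2} {x : Pt} (hA : ContDiffAt ℝ 2 A x)
    (hB : ContDiffAt ℝ 2 B x) (ε : ℝ) :
    jet₂ (fun y => A y + ε • B y) x = jet₂ A x + ε • jet₂ B x := by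
  have h : partials₂ (fun y => A y + ε • B y) x = partials₂ A x + ε • partials₂ B x := by
    funext l
    have e : (fun y => partials (fun y => A y + ε • B y) y) =ᶠ[𝓝 x]
        fun y => partials A y + ε • partials B y := by
      filter_upwards [hA.eventually (by simp), hB.eventually (by simp)] with y h1 h2
      exact partials_add_smul (h1.differentiableAt (by norm_num))
        (h2.differentiableAt (by norm_num)) ε
    have hA' : DifferentiableAt ℝ (partials A) x :=
      (contDiffAt_partials (m := 1) hA (by norm_num)).differentiableAt (by norm_num)
    have hB' : DifferentiableAt ℝ (partials B) x :=
      (contDiffAt_partials (m := 1) hB (by norm_num)).differentiableAt (by norm_num)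
    funext k i j
    have e' := pd_congr (e.fun_comp fun A => A k i j) l
    have := congrFun (congrFun (congrFun (partials_add_smul (differentiableAt_pi.1 hA' k)
      (differentiableAt_pi.1 hB' k) ε) l) i) j
    exact e'.trans this
  simp [jet₂, h, partials_add_smul (hA.differentiableAt (by norm_num))
    (hB.differentiableAt (by norm_num))]

/-! ### The geometry of a metric expressed through its jets. -/

/-- The contravariant components as a field of arrays. -/
def contraArr (g : Field2) (x : Pt) : Arr2 := fun i j => contra g x i j

/-- The covariant torsion as a field of arrays. -/
def torsionArr (g : Field2) (x : Pt) : Arr3 := fun i j k => torsionCov g i j k x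

theorem det_symPart_ne_zero {g : Field2} {x : Pt} (h : contraArr g x ∈ nondeg) :
    (symPart g x).det ≠ 0 := by
  intro h0
  apply h
  change ((symPart g x)⁻¹).det = 0
  rw [Matrix.det_nonsing_inv, h0, Ring.inverse_zero]

theorem contraArr_mem_nondeg {g : Field2} {x : Pt} (h : (symPart g x).det ≠ 0) :
    contraArr g x ∈ nondeg := by
  change ((symPart g x)⁻¹).det ≠ 0
  rw [Matrix.det_nonsing_inv, Ring.inverse_eq_inv']
  exact inv_ne_zero h

theorem inv_contraArr {g : Field2} {x : Pt} (h : contraArr g x ∈ nondeg) :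
    (Matrix.of (contraArr g x))⁻¹ = symPart g x :=
  Matrix.nonsing_inv_nonsing_inv _ (isUnit_iff_ne_zero.2 (det_symPart_ne_zero h))

theorem symPart_eq_lower {g : Field2} {x : Pt} (h : contraArr g x ∈ nondeg) (i j : Fin 4) :
    symPart g x i j = lower i j (contraArr g x) := by
  rw [lower, inv_contraArr h]

theorem eventually_nondeg {C : Pt → Arr2} {x : Pt} (hc : ContinuousAt C x) (h : C x ∈ nondeg) :
    ∀ᶠ y in 𝓝 x, C y ∈ nondeg :=
  hc.eventually (isOpen_nondeg.mem_nhds h)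

/-- Near `x` the covariant components are `lower` composed with the contravariant field, so the
chain rule turns their derivatives into the expression in the 1-jet. -/
theorem christoffel_eq_jet {g : Field2} {x : Pt} (hd : DifferentiableAt ℝ (contraArr g) x)
    (h : contraArr g x ∈ nondeg) (i j k : Fin 4) :
    christoffel g i j k x = jetChristoffel i j k (jet₁ (contraArr g) x) := by
  have key : ∀ a b c, pd c (fun y => symPart g y a b) x
      = fderiv ℝ (lower a b) (contraArr g x) (partials (contraArr g) x c) := by
    intro a b c
    have e : (fun y => symPart g y a b) =ᶠ[𝓝 x] fun y => lower a b (contraArr g y) := by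
      filter_upwards [eventually_nondeg hd.continuousAt h] with y hy
      exact symPart_eq_lower hy a b
    have hl : DifferentiableAt ℝ (lower a b) (contraArr g x) :=
      (contDiffAt_lower h a b).differentiableAt (by simp)
    rw [pd_congr e, pd, fderiv_fun_comp x hl hd, ContinuousLinearMap.comp_apply,
      fderiv_arr2_apply hd]
  simp only [christoffel, key]
  rfl

theorem pd_jetChristoffel {C : Pt → Arr2} {x : Pt} (hC : ContDiffAt ℝ 2 C x)
    (h : C x ∈ nondeg) (l i j k : Fin 4) :
    pd l (fun y => jetChristoffel i j k (jet₁ C y)) x = jetChristoffelDeriv l i j k (jet₂ C x) := by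
  have h1 : DifferentiableAt ℝ (jetChristoffel i j k) (jet₁ C x) :=
    (contDiffAt_jetChristoffel (p := jet₁ C x) h i j k).differentiableAt (by simp)
  rw [pd, fderiv_fun_comp x h1 ((contDiffAt_jet₁ hC).differentiableAt (by norm_num)),
    ContinuousLinearMap.comp_apply, fderiv_jet₁_apply hC]
  rfl

theorem christoffel_eventuallyEq_jet {g : Field2} {x : Pt} (hd : ContDiffAt ℝ 2 (contraArr g) x)
    (h : contraArr g x ∈ nondeg) (i j k : Fin 4) :
    christoffel g i j k =ᶠ[𝓝 x] fun y => jetChristoffel i j k (jet₁ (contraArr g) y) := by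
  filter_upwards [hd.eventually (by simp), eventually_nondeg hd.continuousAt h] with y h1 h2
  exact christoffel_eq_jet (h1.differentiableAt (by norm_num)) h2 i j k

theorem pd_christoffel_eq_jet {g : Field2} {x : Pt} (hd : ContDiffAt ℝ 2 (contraArr g) x)
    (h : contraArr g x ∈ nondeg) (l i j k : Fin 4) :
    pd l (christoffel g i j k) x = jetChristoffelDeriv l i j k (jet₂ (contraArr g) x) := by
  rw [pd_congr (christoffel_eventuallyEq_jet hd h i j k), pd_jetChristoffel hd h]

theorem ricci_eq_jet {g : Field2} {x : Pt} (hd : ContDiffAt ℝ 2 (contraArr g) x)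
    (h : contraArr g x ∈ nondeg) (i j : Fin 4) :
    ricci g i j x = jetRicci i j (jet₂ (contraArr g) x) := by
  simp only [ricci, riemann, pd_christoffel_eq_jet hd h,
    christoffel_eq_jet (hd.differentiableAt (by norm_num)) h]
  rfl

theorem torsionSq_eq (g : Field2) (x : Pt) :
    torsionSq g x = tripleSq (contraArr g x) (torsionArr g x) := rfl

theorem lagrangian_eq_jet (Λ v' w : ℝ) {g : Field2} {x : Pt}
    (hd : ContDiffAt ℝ 2 (contraArr g) x) (h : contraArr g x ∈ nondeg) :
    √|(symPart g x).det| * (scalarCurv g x - 2 * Λ + matterL v' w g x)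
      = jetLagrangian Λ (v' + w) (jet₂ (contraArr g) x, torsionArr g x) := by
  have e : (Matrix.of (jet₂ (contraArr g) x).1)⁻¹ = symPart g x := inv_contraArr h
  simp only [scalarCurv, ricci_eq_jet hd h, jetLagrangian, e, matterL, torsionSq_eq]
  rfl

/-- Twice the exterior derivative of the anti-symmetric part, in terms of `g_{ij,k} - g_{ji,k}`. -/
theorem torsionCov_eq {g : Field2} {x : Pt} (h : contraArr g x ∈ nondeg)
    (hg : ∀ i j, DifferentiableAt ℝ (fun y => g y i j) x) (i j k : Fin 4) :
    torsionCov g i j k x = 1 / 2 * (pd k (fun y => g y j i - g y i j) x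
      - pd i (fun y => g y j k - g y k j) x + pd j (fun y => g y i k - g y k i) x) := by
  simp only [pd_sub (hg _ _) (hg _ _)]
  -- `D` is the torsion before its first index is raised; lowering that index multiplies by the
  -- inverse of the raising matrix and returns `D`.
  set D : Fin 4 → ℝ := fun a => 1 / 2 * (pd k (fun y => g y j a) x - pd k (fun y => g y a j) x
      - (pd a (fun y => g y j k) x - pd a (fun y => g y k j) x)
      + (pd j (fun y => g y a k) x - pd j (fun y => g y k a) x)) with hD
  have h1 : ∀ a, torsion g a j k x = ((symPart g x)⁻¹.mulVec D) a := by
    intro a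
    simp only [torsion, genChristoffel, Matrix.mulVec, dotProduct, ← mul_sub,
      ← Finset.sum_sub_distrib, Finset.mul_sum, hD]
    refine Finset.sum_congr rfl fun b _ => ?_
    simp only [contra]
    ring
  have h2 : torsionCov g i j k x = ((symPart g x).mulVec ((symPart g x)⁻¹.mulVec D)) i := by
    simp only [torsionCov, h1]
    rfl
  rw [h2, Matrix.mulVec_mulVec, Matrix.mul_nonsing_inv _
    (isUnit_iff_ne_zero.2 (det_symPart_ne_zero h)), Matrix.one_mulVec]

theorem symPart_transpose (g : Field2) (x : Pt) : (symPart g x).transpose = symPart g x := by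
  simp [symPart, add_comm]

theorem contra_transpose (g : Field2) (x : Pt) : (contra g x).transpose = contra g x := by
  rw [contra, Matrix.transpose_nonsing_inv, symPart_transpose]

theorem antiPart_transpose (g : Field2) (x : Pt) : (antiPart g x).transpose = -antiPart g x := by
  rw [antiPart, Matrix.transpose_smul, ← smul_neg]
  simp

/-! ### The varied metric -/

/-- A field of matrices as a field of arrays. -/
def toArr (h : Field2) (x : Pt) : Arr2 := fun i j => h x i j

theorem symPart_vary {g h : Field2} {x : Pt} (hs : (h x).IsSymm) (ε : ℝ) :
    symPart (vary g h ε) x = (contra g x + ε • h x)⁻¹ := by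
  have h1 : ((contra g x + ε • h x)⁻¹).transpose = (contra g x + ε • h x)⁻¹ := by
    rw [Matrix.transpose_nonsing_inv, Matrix.transpose_add, contra_transpose,
      Matrix.transpose_smul, hs.eq]
  rw [symPart, vary, Matrix.transpose_add, h1, antiPart_transpose]
  ext i j
  simp
  ring

theorem contraArr_vary {g h : Field2} {x : Pt} (hs : (h x).IsSymm) {ε : ℝ}
    (hn : contraArr g x + ε • toArr h x ∈ nondeg) :
    contraArr (vary g h ε) x = contraArr g x + ε • toArr h x := by
  have h1 : contra (vary g h ε) x = contra g x + ε • h x := by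
    rw [contra, symPart_vary hs, Matrix.nonsing_inv_nonsing_inv
      (contra g x + ε • h x) (isUnit_iff_ne_zero.2 hn)]
  funext i j
  rw [contraArr, h1]
  rfl

section Vary

variable {g h : Field2} {x : Pt} (hs : ∀ y, (h y).IsSymm)
  (hg : ContDiffAt ℝ 2 (contraArr g) x) (hh : ContDiffAt ℝ 2 (toArr h) x)
  {ε : ℝ} (hn : contraArr g x + ε • toArr h x ∈ nondeg)
include hs hg hh hn

theorem contraArr_vary_eventuallyEq :
    contraArr (vary g h ε) =ᶠ[𝓝 x] fun y => contraArr g y + ε • toArr h y := by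
  have hc : ContinuousAt (fun y => contraArr g y + ε • toArr h y) x :=
    hg.continuousAt.add (hh.continuousAt.const_smul ε)
  filter_upwards [eventually_nondeg hc hn] with y hy
  exact contraArr_vary (hs y) hy

theorem contDiffAt_contraArr_vary : ContDiffAt ℝ 2 (contraArr (vary g h ε)) x :=
  (hg.add (hh.const_smul ε)).congr_of_eventuallyEq (contraArr_vary_eventuallyEq hs hg hh hn)

theorem jet₂_contraArr_vary :
    jet₂ (contraArr (vary g h ε)) x = jet₂ (contraArr g) x + ε • jet₂ (toArr h) x := by
  rw [jet₂_congr (contraArr_vary_eventuallyEq hs hg hh hn), jet₂_add_smul hg hh]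

/-- By `torsionCov_eq` the covariant torsion is built from `g_{ij} - g_{ji}`, from which the varied
symmetric part drops out. -/
theorem torsionCov_vary (hgx : contraArr g x ∈ nondeg)
    (hgd : ∀ i j, DifferentiableAt ℝ (fun y => g y i j) x) (i j k : Fin 4) :
    torsionCov (vary g h ε) i j k x = torsionCov g i j k x := by
  have hn' : contraArr (vary g h ε) x ∈ nondeg := by rwa [contraArr_vary (hs x) hn]
  have hd' := contDiffAt_contraArr_vary hs hg hh hn
  have hev : ∀ a b, (fun y => vary g h ε y a b) =ᶠ[𝓝 x]
      fun y => lower a b (contraArr (vary g h ε) y) + 1 / 2 * (g y a b - g y b a) := by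
    intro a b
    filter_upwards [eventually_nondeg hd'.continuousAt hn'] with y hy
    rw [← symPart_eq_lower hy, symPart_vary (hs y)]
    simp [vary, antiPart]
  have hdv : ∀ a b, DifferentiableAt ℝ (fun y => vary g h ε y a b) x := by
    intro a b
    refine DifferentiableAt.congr_of_eventuallyEq ?_ (hev a b)
    have hl : DifferentiableAt ℝ (lower a b) (contraArr (vary g h ε) x) :=
      (contDiffAt_lower hn' a b).differentiableAt (by simp)
    exact (hl.fun_comp' x (hd'.differentiableAt (by norm_num))).add
      (((hgd a b).sub (hgd b a)).const_mul _)
  have hdiff : ∀ a b, (fun y => vary g h ε y a b - vary g h ε y b a)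
      = fun y => g y a b - g y b a := by
    intro a b
    funext y
    have h1 : ((contra g y + ε • h y)⁻¹).transpose = (contra g y + ε • h y)⁻¹ := by
      rw [Matrix.transpose_nonsing_inv, Matrix.transpose_add, contra_transpose,
        Matrix.transpose_smul, (hs y).eq]
    have h2 := congrFun (congrFun h1 b) a
    rw [Matrix.transpose_apply] at h2
    simp [vary, antiPart, h2]
    ring
  rw [torsionCov_eq hn' hdv, torsionCov_eq hgx hgd]
  simp only [hdiff]

/-- The 2-jet is affine in `ε` and the torsion is constant, hence the direction `(jet₂ (toArr h) x,
0)`. -/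
theorem lagrangian_vary_eq_jet (Λ v' w : ℝ) (hgx : contraArr g x ∈ nondeg)
    (hgd : ∀ i j, DifferentiableAt ℝ (fun y => g y i j) x) :
    √|(symPart (vary g h ε) x).det| * (scalarCurv (vary g h ε) x - 2 * Λ
        + matterL v' w (vary g h ε) x)
      = jetLagrangian Λ (v' + w) ((jet₂ (contraArr g) x, torsionArr g x)
        + ε • (jet₂ (toArr h) x, (0 : Arr3))) := by
  have hn' : contraArr (vary g h ε) x ∈ nondeg := by rwa [contraArr_vary (hs x) hn]
  have ht : torsionArr (vary g h ε) x = torsionArr g x := by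
    funext i j k
    exact torsionCov_vary hs hg hh hn hgx hgd i j k
  rw [lagrangian_eq_jet Λ v' w (contDiffAt_contraArr_vary hs hg hh hn) hn',
    jet₂_contraArr_vary hs hg hh hn, ht]
  simp

end Vary

/-! ### The variational derivatives in `tau` and `calW`. -/

theorem symUnit_isSymm (i j : Fin 4) : (symUnit i j).IsSymm := by
  simp [symUnit, Matrix.IsSymm, add_comm]

theorem eventually_nondeg_symUnit {g : Field2} {x : Pt} (hgx : contraArr g x ∈ nondeg) (i j : Fin 4) :
    ∀ᶠ ε : ℝ in 𝓝 0, contraArr g x + ε • toArr (fun _ => symUnit i j) x ∈ nondeg := by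
  -- The pointwise statement is the case of a one-point compact set.
  have h := eventually_line_mem (X := Unit) isOpen_nondeg isCompact_univ
    (y := fun _ => contraArr g x) (z := fun _ => toArr (fun _ => symUnit i j) x)
    (fun _ _ => continuousAt_const) (fun _ _ => continuousAt_const) (fun _ _ => hgx)
  exact h.mono fun ε hε => hε () trivial

section VarDeriv

variable {g : Field2} {x : Pt}

theorem varDeriv_contra (hgx : contraArr g x ∈ nondeg) (i j c d : Fin 4) :
    varDeriv (fun g' y => contra g' y c d) g i j x = symUnit i j c d := by
  have e : (fun ε : ℝ => contra (vary g (fun _ => symUnit i j) ε) x c d) =ᶠ[𝓝 0]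
      fun ε => contra g x c d + ε * symUnit i j c d := by
    filter_upwards [eventually_nondeg_symUnit hgx i j] with ε hε
    exact congrFun (congrFun (contraArr_vary (symUnit_isSymm i j) hε) c) d
  rw [varDeriv, e.deriv_eq]
  simp

theorem varDeriv_torsionCov (hg : ContDiffAt ℝ 2 (contraArr g) x) (hgx : contraArr g x ∈ nondeg)
    (hgd : ∀ i j, DifferentiableAt ℝ (fun y => g y i j) x)
    (i j a b c : Fin 4) : varDeriv (fun g' => torsionCov g' a b c) g i j x = 0 := by
  have e : (fun ε : ℝ => torsionCov (vary g (fun _ => symUnit i j) ε) a b c x) =ᶠ[𝓝 0]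
      fun ε => torsionCov g a b c x := by
    filter_upwards [eventually_nondeg_symUnit hgx i j] with ε hε
    exact torsionCov_vary (fun _ => symUnit_isSymm i j) hg contDiffAt_const hε hgx hgd a b c
  rw [varDeriv, e.deriv_eq]
  simp

theorem calW_eq_zero (hg : ContDiffAt ℝ 2 (contraArr g) x) (hgx : contraArr g x ∈ nondeg)
    (hgd : ∀ i j, DifferentiableAt ℝ (fun y => g y i j) x) (i j : Fin 4) :
    calW g i j x = 0 := by
  simp [calW, varDeriv_torsionCov hg hgx hgd]

theorem tau_eq (hgx : contraArr g x ∈ nondeg) (i j : Fin 4) :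
    tau g i j x = ∑ c, ∑ d, ∑ e, ∑ a, ∑ b, ∑ z, symUnit i j c d * contra g x e a * contra g x b z
      * torsionCov g e c b x * torsionCov g a d z x := by
  simp only [tau, varDeriv_contra hgx]

end VarDeriv

/-! ### First variations of the volume and of the cubic torsion term. -/

theorem hasDerivAt_sqrt_abs {a : ℝ} (ha : a ≠ 0) :
    HasDerivAt (fun a => √|a|) (√|a| / (2 * a)) a := by
  have h := (hasDerivAt_abs ha).sqrt (abs_ne_zero.2 ha)
  convert h using 1
  have h0 : (0 : ℝ) < |a| := abs_pos.2 ha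
  have hq : √|a| ≠ 0 := (Real.sqrt_pos.2 h0).ne'
  rw [div_eq_div_iff (by simpa using ha) (by positivity)]
  have hsq : √|a| * √|a| = |a| := Real.mul_self_sqrt h0.le
  rcases lt_or_gt_of_ne ha with hn | hp
  · rw [abs_of_neg hn] at hsq ⊢
    simp only [sign_neg hn, SignType.coe_neg, SignType.coe_one]
    linear_combination 2 * hsq
  · rw [abs_of_pos hp] at hsq ⊢
    simp only [sign_pos hp, SignType.coe_one]
    linear_combination 2 * hsq

/-- Factoring out `A` reduces to `det (1 + ε M)`, which is `1 + ε tr M` plus a multiple of `ε ^ 2`.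
-/
theorem hasDerivAt_det_line {A : Matrix (Fin 4) (Fin 4) ℝ} (hA : A.det ≠ 0)
    (B : Matrix (Fin 4) (Fin 4) ℝ) :
    HasDerivAt (fun ε : ℝ => (A + ε • B).det) (A.det * (A⁻¹ * B).trace) 0 := by
  have e : (fun ε : ℝ => (A + ε • B).det) = fun ε : ℝ => A.det * (1 + ε • (A⁻¹ * B)).det := by
    funext ε
    rw [← Matrix.det_mul, mul_add, Matrix.mul_smul, ← mul_assoc,
      Matrix.mul_nonsing_inv _ (isUnit_iff_ne_zero.2 hA), mul_one, one_mul]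
  rw [e]
  refine HasDerivAt.const_mul _ ?_
  have h := fun r : ℝ => Matrix.det_one_add_smul r (A⁻¹ * B)
  simp only [h]
  set P := ((1 + (Polynomial.X : Polynomial ℝ) • (A⁻¹ * B).map Polynomial.C).det.divX).divX
  have h1 := ((hasDerivAt_id (0 : ℝ)).const_mul (A⁻¹ * B).trace).const_add 1
  have h2 := (P.hasDerivAt 0).fun_mul ((hasDerivAt_id (0 : ℝ)).fun_pow 2)
  simpa using h1.fun_add h2

theorem hasDerivAt_volume_line {A : Matrix (Fin 4) (Fin 4) ℝ} (hA : A.det ≠ 0)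
    (B : Matrix (Fin 4) (Fin 4) ℝ) :
    HasDerivAt (fun ε : ℝ => √|((A + ε • B)⁻¹).det|)
      (-(1 / 2) * √|(A⁻¹).det| * ∑ i, ∑ j, A⁻¹ i j * B j i) 0 := by
  have hA' : (A + (0 : ℝ) • B).det ≠ 0 := by simpa using hA
  have h1 := (hasDerivAt_det_line hA B).fun_inv hA'
  have h2 := (hasDerivAt_sqrt_abs (inv_ne_zero hA')).comp (0 : ℝ) h1
  simp only [Matrix.det_nonsing_inv, Ring.inverse_eq_inv']
  refine h2.congr_deriv ?_
  have ht : (A⁻¹ * B).trace = ∑ i, ∑ j, A⁻¹ i j * B j i := by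
    simp [Matrix.trace, Matrix.mul_apply]
  rw [← ht]
  simp only [zero_smul, add_zero]
  field_simp

theorem sum₄_reindex {ι M : Type*} [Fintype ι] [AddCommMonoid M] (f : ι → ι → ι → ι → M)
    (e : ι × ι × ι × ι ≃ ι × ι × ι × ι) :
    ∑ i, ∑ j, ∑ a, ∑ b, f i j a b = ∑ p, ∑ q, ∑ r, ∑ s, f (e (p, q, r, s)).1
      (e (p, q, r, s)).2.1 (e (p, q, r, s)).2.2.1 (e (p, q, r, s)).2.2.2 := by
  have h := (Equiv.sum_comp e fun t => f t.1 t.2.1 t.2.2.1 t.2.2.2).symm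
  simpa only [Fintype.sum_prod_type] using h

theorem sum₄_swap {ι M : Type*} [Fintype ι] [AddCommMonoid M] (f : ι → ι → ι → ι → M) :
    ∑ c, ∑ d, ∑ e, ∑ a, f c d e a = ∑ c, ∑ d, ∑ e, ∑ a, f e a c d :=
  sum₄_reindex f ⟨fun p => (p.2.2.1, p.2.2.2, p.1, p.2.1),
    fun p => (p.2.2.1, p.2.2.2, p.1, p.2.1), fun _ => rfl, fun _ => rfl⟩

/-- The contraction `X^{cd} Y^{ea} Z^{bz} T_{ecb} T_{adz}`. -/
def tripleForm (T : Arr3) (X Y Z : Arr2) : ℝ :=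
  ∑ c, ∑ d, ∑ e, ∑ a, ∑ b, ∑ z, X c d * Y e a * Z b z * T e c b * T a d z

/-- Exchanging `X` and `Y` transposes the first two indices in both torsion factors, and the two
signs cancel. -/
theorem tripleForm_swap₁₂ {T : Arr3} (hT : ∀ i j k, T j i k = -T i j k) (X Y Z : Arr2) :
    tripleForm T Y X Z = tripleForm T X Y Z := by
  rw [tripleForm, sum₄_swap (fun c d e a => ∑ b, ∑ z, Y c d * X e a * Z b z * T e c b * T a d z)]
  refine Finset.sum_congr rfl fun c _ => Finset.sum_congr rfl fun d _ => Finset.sum_congr rfl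
    fun e _ => Finset.sum_congr rfl fun a _ => Finset.sum_congr rfl fun b _ =>
    Finset.sum_congr rfl fun z _ => ?_
  rw [hT e c b, hT a d z]
  ring

theorem tripleForm_swap₂₃ {T : Arr3} (hT : ∀ i j k, T j i k = -T i j k)
    (hT' : ∀ i j k, T i k j = -T i j k) (X Y Z : Arr2) :
    tripleForm T X Z Y = tripleForm T X Y Z := by
  rw [tripleForm, tripleForm]
  refine Finset.sum_congr rfl fun c _ => Finset.sum_congr rfl fun d _ => ?_
  rw [sum₄_swap (fun e a b z => X c d * Z e a * Y b z * T e c b * T a d z)]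
  refine Finset.sum_congr rfl fun e _ => Finset.sum_congr rfl fun a _ => Finset.sum_congr rfl
    fun b _ => Finset.sum_congr rfl fun z _ => ?_
  have h : ∀ p q r, T r q p = -T p q r := fun p q r => by rw [hT, hT', hT]; ring
  rw [h e c b, h a d z]
  ring

/-- The product rule puts `B` in each of the three slots in turn; total antisymmetry makes the three
terms equal. -/
theorem hasDerivAt_tripleSq_line {T : Arr3} (hT : ∀ i j k, T j i k = -T i j k)
    (hT' : ∀ i j k, T i k j = -T i j k) (A B : Arr2) :
    HasDerivAt (fun ε : ℝ => tripleSq (A + ε • B) T) (3 * tripleForm T B A A) 0 := by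
  have hl : ∀ c d, HasDerivAt (fun ε : ℝ => (A + ε • B) c d) (B c d) 0 := fun c d => by
    simpa using ((hasDerivAt_id (0 : ℝ)).mul_const (B c d)).const_add (A c d)
  have h : HasDerivAt (fun ε : ℝ => tripleSq (A + ε • B) T) _ 0 :=
    HasDerivAt.fun_sum fun c _ => HasDerivAt.fun_sum fun d _ => HasDerivAt.fun_sum fun e _ =>
      HasDerivAt.fun_sum fun a _ => HasDerivAt.fun_sum fun b _ => HasDerivAt.fun_sum fun z _ =>
      (((((hl c d).fun_mul (hl e a)).fun_mul (hl b z)).mul_const (T e c b)).mul_const (T a d z))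
  refine h.congr_deriv ?_
  have e : 3 * tripleForm T B A A
      = tripleForm T B A A + tripleForm T A B A + tripleForm T A A B := by
    rw [tripleForm_swap₂₃ hT hT' A B A, tripleForm_swap₁₂ hT B A A]; ring
  rw [e]
  simp only [tripleForm, ← Finset.sum_add_distrib, zero_smul, add_zero]
  refine Finset.sum_congr rfl fun c _ => Finset.sum_congr rfl fun d _ => Finset.sum_congr rfl
    fun e _ => Finset.sum_congr rfl fun a _ => Finset.sum_congr rfl fun b _ =>
    Finset.sum_congr rfl fun z _ => ?_
  ring

/-! ### The Palatini identity and the first variation of the density. -/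

/-- The algebraic part of the Palatini identity. -/
theorem palatini_algebra {A : Arr2} {Γ : Arr3} (γ : Arr3)
    (hΓ : ∀ i j k, Γ i j k = Γ i k j) :
    ∑ i, ∑ j, A i j * ∑ a, (∑ b, (γ b i j * Γ a b a + Γ b i j * γ a b a)
        - ∑ b, (γ b i a * Γ a b j + Γ b i a * γ a b j))
      = ∑ k, (∑ i, ∑ j, (A i j * ∑ b, Γ b k b - ∑ b, A b j * Γ i b k - ∑ b, A i b * Γ j b k)
            * γ k i j
          - ∑ i, ∑ a, (A i k * ∑ b, Γ b k b - ∑ b, A b k * Γ i b k - ∑ b, A i b * Γ k b k)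
            * γ a i a) := by
  have h1 := sum₄_reindex (fun i j a b => A i j * γ b i j * Γ a b a)
    ⟨fun p => (p.2.1, p.2.2.1, p.2.2.2, p.1), fun q => (q.2.2.2, q.1, q.2.1, q.2.2.1),
      fun _ => rfl, fun _ => rfl⟩
  have h2 := sum₄_reindex (fun i j a b => A i j * Γ b i j * γ a b a)
    ⟨fun p => (p.2.2.2, p.1, p.2.2.1, p.2.1), fun q => (q.2.1, q.2.2.2, q.2.2.1, q.1),
      fun _ => rfl, fun _ => rfl⟩
  have h3 := sum₄_reindex (fun i j a b => A i j * γ b i a * Γ a b j)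
    ⟨fun p => (p.2.1, p.2.2.2, p.2.2.1, p.1), fun q => (q.2.2.2, q.1, q.2.2.1, q.2.1),
      fun _ => rfl, fun _ => rfl⟩
  have h4 := sum₄_reindex (fun i j a b => A i j * Γ b i a * γ a b j)
    ⟨fun p => (p.2.2.2, p.2.2.1, p.1, p.2.1), fun q => (q.2.2.1, q.2.2.2, q.2.1, q.1),
      fun _ => rfl, fun _ => rfl⟩
  -- `h1` to `h4` match the left-hand terms with terms on the right; `h5` exchanges `k` and `b`, so
  -- that the two leftover terms with a trace of `Γ` cancel.
  have h5 := sum₄_reindex (fun k i a b => A i k * Γ b k b * γ a i a)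
    ⟨fun p => (p.2.2.2, p.2.1, p.2.2.1, p.1), fun q => (q.2.2.2, q.2.1, q.2.2.1, q.1),
      fun _ => rfl, fun _ => rfl⟩
  simp only [Equiv.coe_fn_mk] at h1 h2 h3 h4 h5
  have hL : ∑ i, ∑ j, A i j * ∑ a, (∑ b, (γ b i j * Γ a b a + Γ b i j * γ a b a)
        - ∑ b, (γ b i a * Γ a b j + Γ b i a * γ a b j))
      = ∑ i, ∑ j, ∑ a, ∑ b, A i j * γ b i j * Γ a b a
        + ∑ i, ∑ j, ∑ a, ∑ b, A i j * Γ b i j * γ a b a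
        - ∑ i, ∑ j, ∑ a, ∑ b, A i j * γ b i a * Γ a b j
        - ∑ i, ∑ j, ∑ a, ∑ b, A i j * Γ b i a * γ a b j := by
    simp only [Finset.mul_sum, ← Finset.sum_add_distrib, ← Finset.sum_sub_distrib]
    refine Finset.sum_congr rfl fun i _ => Finset.sum_congr rfl fun j _ =>
      Finset.sum_congr rfl fun a _ => Finset.sum_congr rfl fun b _ => ?_
    ring
  have hR : ∑ k, (∑ i, ∑ j, (A i j * ∑ b, Γ b k b - ∑ b, A b j * Γ i b k - ∑ b, A i b * Γ j b k)
            * γ k i j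
          - ∑ i, ∑ a, (A i k * ∑ b, Γ b k b - ∑ b, A b k * Γ i b k - ∑ b, A i b * Γ k b k)
            * γ a i a)
      = ∑ k, ∑ i, ∑ j, ∑ b, A i j * γ k i j * Γ b k b
        - ∑ k, ∑ i, ∑ j, ∑ b, A b j * Γ i b k * γ k i j
        - ∑ k, ∑ i, ∑ j, ∑ b, A i b * γ k i j * Γ j k b
        - ∑ k, ∑ i, ∑ a, ∑ b, A i k * Γ b k b * γ a i a
        + ∑ k, ∑ i, ∑ a, ∑ b, A b k * Γ i b k * γ a i a
        + ∑ k, ∑ i, ∑ a, ∑ b, A i b * Γ k b k * γ a i a := by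
    simp only [Finset.mul_sum, Finset.sum_mul, ← Finset.sum_add_distrib,
      ← Finset.sum_sub_distrib]
    refine Finset.sum_congr rfl fun k _ => Finset.sum_congr rfl fun i _ =>
      Finset.sum_congr rfl fun j _ => Finset.sum_congr rfl fun b _ => ?_
    rw [hΓ j k b]
    ring
  rw [hL, hR, h1, h2, h3, h4, h5]
  ring

/-- The volume density of the symmetric part. -/
def volDensity (g : Field2) (x : Pt) : ℝ := √|(symPart g x).det|

/-- First variation of the Christoffel symbols. -/
def christoffelVar (g h : Field2) (i j k : Fin 4) (x : Pt) : ℝ :=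
  fderiv ℝ (jetChristoffel i j k) (jet₁ (contraArr g) x) (jet₁ (toArr h) x)

/-- The vector density whose divergence is the second-order part of the first variation. -/
def flux (g h : Field2) (k : Fin 4) (x : Pt) : ℝ :=
  ∑ i, ∑ j, (volDensity g x * contra g x i j) * christoffelVar g h k i j x
    - ∑ i, ∑ a, (volDensity g x * contra g x i k) * christoffelVar g h a i a x

/-- The difference of the two sides of the equations of motion. -/
def eulerLagrange (Λ κ : ℝ) (g : Field2) (i j : Fin 4) (x : Pt) : ℝ :=
  ricci g i j x - 1 / 2 * scalarCurv g x * symPart g x i j + Λ * symPart g x i j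
    - κ * (3 * tau g i j x + 2 * calW g i j x - 1 / 2 * torsionSq g x * symPart g x i j)

theorem torsionCov_swap₁₂ {g : Field2} {x : Pt} (h : contraArr g x ∈ nondeg)
    (hg : ∀ i j, DifferentiableAt ℝ (fun y => g y i j) x) (i j k : Fin 4) :
    torsionCov g j i k x = -torsionCov g i j k x := by
  simp only [torsionCov_eq h hg, pd_sub (hg _ _) (hg _ _)]
  ring

theorem torsionCov_swap₂₃ {g : Field2} {x : Pt} (h : contraArr g x ∈ nondeg)
    (hg : ∀ i j, DifferentiableAt ℝ (fun y => g y i j) x) (i j k : Fin 4) :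
    torsionCov g i k j x = -torsionCov g i j k x := by
  simp only [torsionCov_eq h hg, pd_sub (hg _ _) (hg _ _)]
  ring

theorem symPart_comm (g : Field2) (x : Pt) (i j : Fin 4) : symPart g x i j = symPart g x j i :=
  congrFun (congrFun (symPart_transpose g x) j) i

theorem christoffel_comm (g : Field2) (i j k : Fin 4) : christoffel g i j k = christoffel g i k j := by
  funext x
  have h : ∀ a b, (fun y => symPart g y a b) = fun y => symPart g y b a := fun a b => by
    funext y; exact symPart_comm g y a b
  simp only [christoffel]
  congr 1
  refine Finset.sum_congr rfl fun a _ => ?_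
  rw [h j a, h j k, h a k]
  ring

theorem two_le_infty : (2 : ℕ∞ω) ≤ ∞ := by
  exact WithTop.coe_le_coe.2 (le_top : (2 : ℕ∞) ≤ ⊤)

section FirstVariation

variable {g h : Field2} {x : Pt}

theorem contDiffAt_christoffelVar (hg : ContDiffAt ℝ 2 (contraArr g) x)
    (hgx : contraArr g x ∈ nondeg) (hh : ContDiffAt ℝ 2 (toArr h) x) (i j k : Fin 4) :
    ContDiffAt ℝ 1 (christoffelVar g h i j k) x := by
  have h1 : ContDiffAt ℝ 1 (fderiv ℝ (jetChristoffel i j k)) (jet₁ (contraArr g) x) :=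
    ((contDiffAt_jetChristoffel (p := jet₁ (contraArr g) x) hgx i j k).fderiv_right (m := ∞)
      (by simp)).of_le (by simp)
  exact (ContDiffAt.comp (g := fderiv ℝ (jetChristoffel i j k)) x h1
    (contDiffAt_jet₁ hg)).clm_apply (contDiffAt_jet₁ hh)

theorem hasDerivAt_jetChristoffel_line (hgx : contraArr g x ∈ nondeg) (i j k : Fin 4) :
    HasDerivAt (fun ε : ℝ => jetChristoffel i j k (jet₁ (contraArr g) x + ε • jet₁ (toArr h) x))
      (christoffelVar g h i j k x) 0 :=
  hasDerivAt_comp_line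
    ((contDiffAt_jetChristoffel (p := jet₁ (contraArr g) x) hgx i j k).differentiableAt (by simp))

/-- Varying the derivative of `Γ` gives the derivative of the variation of `Γ`; this is what makes
the second-order terms a divergence. -/
theorem hasDerivAt_jetChristoffelDeriv_line (hg : ContDiffAt ℝ 2 (contraArr g) x)
    (hgx : contraArr g x ∈ nondeg) (hh : ContDiffAt ℝ 2 (toArr h) x) (l i j k : Fin 4) :
    HasDerivAt (fun ε : ℝ => jetChristoffelDeriv l i j k
        (jet₂ (contraArr g) x + ε • jet₂ (toArr h) x))
      (pd l (christoffelVar g h i j k) x) 0 := by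
  have hΦ : ContDiffAt ℝ 2 (jetChristoffel i j k) (jet₁ (contraArr g) x) :=
    (contDiffAt_jetChristoffel (p := jet₁ (contraArr g) x) hgx i j k).of_le
      two_le_infty
  have h1 := hasDerivAt_fderiv_line (z := jet₁ (toArr h) x)
    (p := (partials (contraArr g) x l, partials₂ (contraArr g) x l))
    (q := (partials (toArr h) x l, partials₂ (toArr h) x l)) hΦ
  have h2 := fderiv_fderiv_comp_apply (v := Pi.single l 1) hΦ
    ((contDiffAt_jet₁ hg).differentiableAt (by norm_num))
    ((contDiffAt_jet₁ hh).differentiableAt (by norm_num))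
  rw [fderiv_jet₁_apply hg, fderiv_jet₁_apply hh] at h2
  rw [← h2] at h1
  exact h1

/-- First variation of the Ricci tensor. -/
def ricciVar (g h : Field2) (i j : Fin 4) (x : Pt) : ℝ :=
  ∑ a, (pd a (christoffelVar g h a i j) x - pd j (christoffelVar g h a i a) x
    + ∑ b, (christoffelVar g h b i j x * christoffel g a b a x
        + christoffel g b i j x * christoffelVar g h a b a x)
    - ∑ b, (christoffelVar g h b i a x * christoffel g a b j x
        + christoffel g b i a x * christoffelVar g h a b j x))

theorem hasDerivAt_jetRicci_line (hg : ContDiffAt ℝ 2 (contraArr g) x)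
    (hgx : contraArr g x ∈ nondeg) (hh : ContDiffAt ℝ 2 (toArr h) x) (i j : Fin 4) :
    HasDerivAt (fun ε : ℝ => jetRicci i j (jet₂ (contraArr g) x + ε • jet₂ (toArr h) x))
      (ricciVar g h i j x) 0 := by
  have h1 := fun i j k => hasDerivAt_jetChristoffel_line (h := h) hgx i j k
  have h2 := fun l i j k => hasDerivAt_jetChristoffelDeriv_line hg hgx hh l i j k
  have h3 : HasDerivAt
      (fun ε : ℝ => jetRicci i j (jet₂ (contraArr g) x + ε • jet₂ (toArr h) x)) _ 0 :=
    HasDerivAt.fun_sum fun a _ => (((h2 a a i j).fun_sub (h2 j a i a)).fun_add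
      (HasDerivAt.fun_sum fun b _ => (h1 b i j).fun_mul (h1 a b a))).fun_sub
      (HasDerivAt.fun_sum fun b _ => (h1 b i a).fun_mul (h1 a b j))
  refine h3.congr_deriv ?_
  simp only [ricciVar, christoffel_eq_jet (hg.differentiableAt (by norm_num)) hgx, zero_smul,
    add_zero]
  rfl

/-- Metric compatibility of the connection, for the densities `√|g| g^{ij}`. -/
def IsCompatible (g : Field2) (x : Pt) : Prop :=
  ∀ k i j, pd k (fun y => volDensity g y * contra g y i j) x =
    volDensity g x * (contra g x i j * ∑ b, christoffel g b k b x
      - ∑ b, contra g x b j * christoffel g i b k x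
      - ∑ b, contra g x i b * christoffel g j b k x)

theorem contDiffAt_volDensity (hg : ContDiffAt ℝ 2 (contraArr g) x)
    (hgx : contraArr g x ∈ nondeg) : ContDiffAt ℝ 2 (volDensity g) x := by
  have h1 : ContDiffAt ℝ 2 (fun y => √|((Matrix.of (contraArr g y))⁻¹).det|) x :=
    ContDiffAt.comp (g := fun C : Arr2 => √|((Matrix.of C)⁻¹).det|) x
      ((contDiffAt_volume hgx).of_le two_le_infty) hg
  refine h1.congr_of_eventuallyEq ?_
  filter_upwards [eventually_nondeg hg.continuousAt hgx] with y hy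
  rw [inv_contraArr hy, volDensity]

theorem contDiffAt_densitizedContra (hg : ContDiffAt ℝ 2 (contraArr g) x)
    (hgx : contraArr g x ∈ nondeg) (i j : Fin 4) :
    ContDiffAt ℝ 2 (fun y => volDensity g y * contra g y i j) x :=
  (contDiffAt_volDensity hg hgx).mul (contDiffAt_pi.1 (contDiffAt_pi.1 hg i) j)

theorem contDiffAt_flux (hg : ContDiffAt ℝ 2 (contraArr g) x)
    (hgx : contraArr g x ∈ nondeg) (hh : ContDiffAt ℝ 2 (toArr h) x) (k : Fin 4) :
    ContDiffAt ℝ 1 (flux g h k) x := by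
  have h1 := contDiffAt_christoffelVar hg hgx hh
  have h2 : ∀ i j, ContDiffAt ℝ 1 (fun y => volDensity g y * contra g y i j) x := fun i j =>
    (contDiffAt_densitizedContra hg hgx i j).of_le (by norm_num)
  exact (ContDiffAt.sum fun i _ => ContDiffAt.sum fun j _ => (h2 i j).mul (h1 k i j)).sub
    (ContDiffAt.sum fun i _ => ContDiffAt.sum fun a _ => (h2 i k).mul (h1 a i a))

/-- **Palatini identity**, contracted. -/
theorem palatini (hg : ContDiffAt ℝ 2 (contraArr g) x)
    (hgx : contraArr g x ∈ nondeg) (hh : ContDiffAt ℝ 2 (toArr h) x) (hc : IsCompatible g x) :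
    volDensity g x * ∑ i, ∑ j, contra g x i j * ricciVar g h i j x = ∑ k, pd k (flux g h k) x := by
  have d1 : ∀ i j k, DifferentiableAt ℝ (christoffelVar g h i j k) x := fun i j k =>
    (contDiffAt_christoffelVar hg hgx hh i j k).differentiableAt (by norm_num)
  have d2 : ∀ i j, DifferentiableAt ℝ (fun y => volDensity g y * contra g y i j) x := fun i j =>
    (contDiffAt_densitizedContra hg hgx i j).differentiableAt (by norm_num)
  have e : ∀ k, pd k (flux g h k) x
      = (∑ i, ∑ j, (pd k (fun y => volDensity g y * contra g y i j) x * christoffelVar g h k i j x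
          + volDensity g x * contra g x i j * pd k (christoffelVar g h k i j) x))
        - ∑ i, ∑ a, (pd k (fun y => volDensity g y * contra g y i k) x * christoffelVar g h a i a x
          + volDensity g x * contra g x i k * pd k (christoffelVar g h a i a) x) := by
    intro k
    have f1 : ∀ i j, DifferentiableAt ℝ
        (fun y => volDensity g y * contra g y i j * christoffelVar g h k i j y) x := fun i j =>
      (d2 i j).mul (d1 k i j)
    have f2 : ∀ i a, DifferentiableAt ℝ
        (fun y => volDensity g y * contra g y i k * christoffelVar g h a i a y) x := fun i a =>
      (d2 i k).mul (d1 a i a)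
    unfold flux
    rw [pd_sub (DifferentiableAt.fun_sum fun i _ => DifferentiableAt.fun_sum fun j _ => f1 i j)
      (DifferentiableAt.fun_sum fun i _ => DifferentiableAt.fun_sum fun a _ => f2 i a),
      pd_sum _ (fun i _ => DifferentiableAt.fun_sum fun j _ => f1 i j),
      pd_sum _ (fun i _ => DifferentiableAt.fun_sum fun a _ => f2 i a)]
    congr 1
    · refine Finset.sum_congr rfl fun i _ => ?_
      rw [pd_sum _ (fun j _ => f1 i j)]
      exact Finset.sum_congr rfl fun j _ => pd_mul (d2 i j) (d1 k i j) k
    · refine Finset.sum_congr rfl fun i _ => ?_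
      rw [pd_sum _ (fun a _ => f2 i a)]
      exact Finset.sum_congr rfl fun a _ => pd_mul (d2 i k) (d1 a i a) k
  -- The brackets here are those of `IsCompatible`, so the terms without derivatives of the varied
  -- connection supply exactly the derivatives of the densities `√|g| g^{ij}`.
  have hpal := palatini_algebra (A := contraArr g x) (Γ := fun i j k => christoffel g i j k x)
    (fun i j k => christoffelVar g h i j k x)
    (fun i j k => congrFun (christoffel_comm g i j k) x)
  have hL : ∑ i, ∑ j, contra g x i j * ricciVar g h i j x
      = (∑ k, ∑ i, ∑ j, contra g x i j * pd k (christoffelVar g h k i j) x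
        - ∑ k, ∑ i, ∑ a, contra g x i k * pd k (christoffelVar g h a i a) x)
        + ∑ i, ∑ j, contraArr g x i j * ∑ a, (∑ b, (christoffelVar g h b i j x
            * christoffel g a b a x + christoffel g b i j x * christoffelVar g h a b a x)
          - ∑ b, (christoffelVar g h b i a x * christoffel g a b j x
            + christoffel g b i a x * christoffelVar g h a b j x)) := by
    have r1 : ∑ k, ∑ i, ∑ j, contra g x i j * pd k (christoffelVar g h k i j) x
        = ∑ i, ∑ j, ∑ k, contra g x i j * pd k (christoffelVar g h k i j) x := by
      rw [Finset.sum_comm]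
      exact Finset.sum_congr rfl fun i _ => Finset.sum_comm
    have r2 : ∑ k, ∑ i, ∑ a, contra g x i k * pd k (christoffelVar g h a i a) x
        = ∑ i, ∑ j, ∑ a, contra g x i j * pd j (christoffelVar g h a i a) x := Finset.sum_comm
    rw [r1, r2]
    simp only [← Finset.sum_add_distrib, ← Finset.sum_sub_distrib]
    refine Finset.sum_congr rfl fun i _ => Finset.sum_congr rfl fun j _ => ?_
    simp only [ricciVar, ← Finset.mul_sum, ← mul_sub, ← mul_add, contraArr,
      ← Finset.sum_add_distrib]
    congr 1
    refine Finset.sum_congr rfl fun a _ => ?_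
    simp only [Finset.sum_sub_distrib]
    ring
  rw [hL, hpal]
  simp only [e, hc _ _ _, mul_add, mul_sub, Finset.mul_sum, Finset.sum_add_distrib,
    Finset.sum_sub_distrib, mul_assoc, sub_mul, Finset.sum_mul, contraArr]
  ring

/-- The first variation of the Lagrangian density, up to a divergence. -/
theorem fderiv_jetLagrangian (Λ κ : ℝ) (hg : ContDiffAt ℝ 2 (contraArr g) x)
    (hgx : contraArr g x ∈ nondeg) (hgd : ∀ i j, DifferentiableAt ℝ (fun y => g y i j) x)
    (hs : (h x).IsSymm) (hh : ContDiffAt ℝ 2 (toArr h) x) (hc : IsCompatible g x) :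
    fderiv ℝ (jetLagrangian Λ κ) (jet₂ (contraArr g) x, torsionArr g x)
        (jet₂ (toArr h) x, (0 : Arr3))
      = volDensity g x * ∑ i, ∑ j, eulerLagrange Λ κ g i j x * h x i j
        + ∑ k, pd k (flux g h k) x := by
  have hL := hasDerivAt_comp_line (z := (jet₂ (toArr h) x, (0 : Arr3)))
    ((contDiffAt_jetLagrangian Λ κ (p := (jet₂ (contraArr g) x, torsionArr g x))
      hgx).differentiableAt (by simp))
  have hinv : (contra g x)⁻¹ = symPart g x := inv_contraArr hgx
  have h1 := hasDerivAt_volume_line (A := contra g x) hgx (h x)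
  have h2 := fun i j => hasDerivAt_jetRicci_line hg hgx hh i j
  have h3 := hasDerivAt_tripleSq_line (T := torsionArr g x)
    (fun i j k => torsionCov_swap₁₂ hgx hgd i j k)
    (fun i j k => torsionCov_swap₂₃ hgx hgd i j k) (contraArr g x) (toArr h x)
  have h4 : ∀ c d, HasDerivAt (fun ε : ℝ => (contraArr g x + ε • toArr h x) c d) (h x c d) 0 :=
    fun c d => by
      simpa [toArr] using ((hasDerivAt_id (0 : ℝ)).mul_const (h x c d)).const_add
        (contraArr g x c d)
  have h5 := h1.fun_mul (((HasDerivAt.fun_sum fun a (_ : a ∈ Finset.univ) =>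
    HasDerivAt.fun_sum fun b (_ : b ∈ Finset.univ) => (h4 a b).fun_mul (h2 a b)).sub_const
      (2 * Λ)).fun_add (h3.const_mul (-κ)))
  have e : (fun ε : ℝ => jetLagrangian Λ κ ((jet₂ (contraArr g) x, torsionArr g x)
      + ε • (jet₂ (toArr h) x, (0 : Arr3)))) = fun ε : ℝ =>
        √|((contra g x + ε • h x)⁻¹).det| * ((∑ a, ∑ b, (contraArr g x + ε • toArr h x) a b
          * jetRicci a b (jet₂ (contraArr g) x + ε • jet₂ (toArr h) x)) - 2 * Λ
          + -κ * tripleSq (contraArr g x + ε • toArr h x) (torsionArr g x)) := by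
    funext ε
    have : (torsionArr g x + ε • (0 : Arr3)) = torsionArr g x := by simp
    simp only [jetLagrangian, Prod.smul_mk, Prod.mk_add_mk, this]
    rfl
  rw [e] at hL
  -- The same derivative, once through `fderiv` and once by the product rule.
  rw [hL.unique h5]
  have htau : ∑ i, ∑ j, tau g i j x * h x i j
      = tripleForm (torsionArr g x) (toArr h x) (contraArr g x) (contraArr g x) := by
    set P : Arr2 := fun c d => ∑ e, ∑ a, ∑ b, ∑ z, contra g x e a * contra g x b z
      * torsionCov g e c b x * torsionCov g a d z x with hP
    -- `symUnit` makes `tau` the symmetrization of `P`; contraction with the symmetric `h` makes the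
    -- symmetrization invisible.
    have t1 : ∀ i j, tau g i j x = 1 / 2 * (P i j + P j i) := by
      intro i j
      have : tau g i j x = ∑ c, ∑ d, symUnit i j c d * P c d := by
        simp only [tau_eq hgx, hP, Finset.mul_sum, mul_assoc]
      rw [this]
      simp [symUnit, Matrix.single_apply, add_mul, mul_add, Finset.sum_add_distrib, ite_and]
    have t2 : tripleForm (torsionArr g x) (toArr h x) (contraArr g x) (contraArr g x)
        = ∑ c, ∑ d, h x c d * P c d := by
      simp only [hP, Finset.mul_sum]
      refine Finset.sum_congr rfl fun c _ => Finset.sum_congr rfl fun d _ => Finset.sum_congr rfl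
        fun e _ => Finset.sum_congr rfl fun a _ => Finset.sum_congr rfl fun b _ =>
        Finset.sum_congr rfl fun z _ => ?_
      simp only [toArr, contraArr, torsionArr]
      ring
    have t3 : ∑ i, ∑ j, P j i * h x i j = ∑ i, ∑ j, P i j * h x i j := by
      rw [Finset.sum_comm]
      exact Finset.sum_congr rfl fun i _ => Finset.sum_congr rfl fun j _ => by rw [hs.apply i j]
    have t4 : ∑ i, ∑ j, tau g i j x * h x i j
        = 1 / 2 * (∑ i, ∑ j, P i j * h x i j + ∑ i, ∑ j, P j i * h x i j) := by
      simp only [t1, Finset.mul_sum, ← Finset.sum_add_distrib]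
      refine Finset.sum_congr rfl fun i _ => Finset.sum_congr rfl fun j _ => ?_
      ring
    rw [t4, t3, t2]
    simp only [mul_comm (h x _ _)]
    ring
  have hE : ∑ i, ∑ j, eulerLagrange Λ κ g i j x * h x i j
      = ∑ i, ∑ j, ricci g i j x * h x i j + (-(1 / 2) * scalarCurv g x + Λ
          + κ * (1 / 2) * torsionSq g x) * ∑ i, ∑ j, symPart g x i j * h x i j
        - 3 * κ * ∑ i, ∑ j, tau g i j x * h x i j := by
    simp only [eulerLagrange, calW_eq_zero hg hgx hgd, Finset.mul_sum,
      ← Finset.sum_add_distrib, ← Finset.sum_sub_distrib]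
    refine Finset.sum_congr rfl fun i _ => Finset.sum_congr rfl fun j _ => ?_
    ring
  have hR : ∑ a, ∑ b, contraArr g x a b * ricci g a b x = scalarCurv g x := rfl
  have hS : ∑ i, ∑ j, symPart g x i j * h x j i = ∑ i, ∑ j, symPart g x i j * h x i j :=
    Finset.sum_congr rfl fun i _ => Finset.sum_congr rfl fun j _ => by rw [hs.apply i j]
  rw [hE, htau, ← palatini hg hgx hh hc]
  simp only [zero_smul, add_zero, ← ricci_eq_jet hg hgx, hinv, ← torsionSq_eq,
    Finset.sum_add_distrib, hR, hS, volDensity]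
  have hR' : ∑ i, ∑ j, h x i j * ricci g i j x = ∑ i, ∑ j, ricci g i j x * h x i j := by
    simp only [mul_comm]
  rw [hR']
  simp only [contraArr]
  ring

end FirstVariation

/-! ### Stationarity and the equations of motion for admissible metrics. -/

/-- The properties of a metric on a region which make the variational principle meaningful
there, together with metric compatibility and symmetry of the Ricci tensor. -/
structure IsAdmissible (M : Set Pt) (g : Field2) : Prop where
  isOpen : IsOpen M
  contDiffAt_contra : ∀ x ∈ M, ContDiffAt ℝ 2 (contraArr g) x
  nondeg : ∀ x ∈ M, contraArr g x ∈ nondeg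
  contDiffAt : ∀ x ∈ M, ∀ i j, ContDiffAt ℝ 1 (fun y => g y i j) x
  compatible : ∀ x ∈ M, IsCompatible g x
  ricci_symm : ∀ x ∈ M, ∀ i j, ricci g i j x = ricci g j i x

theorem symUnit_comm (i j : Fin 4) : symUnit i j = symUnit j i := by
  rw [symUnit, symUnit, add_comm]

/-- The flux is linear in the 1-jet of `h`. Its vanishing off the support makes it globally `C¹`,
although nothing is assumed of `g` outside the region. -/
theorem flux_eq_zero {g h : Field2} {x : Pt} (hx : x ∉ tsupport h) (k : Fin 4) :
    flux g h k x = 0 := by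
  have h0 : toArr h =ᶠ[𝓝 x] fun _ => 0 := by
    filter_upwards [(isClosed_tsupport h).isOpen_compl.mem_nhds hx] with y hy
    funext i j
    rw [toArr, image_eq_zero_of_notMem_tsupport hy]
    rfl
  have h1 : jet₁ (toArr h) x = 0 := by
    rw [jet₁, h0.eq_of_nhds, (partials_congr h0).eq_of_nhds]
    have : partials (fun _ : Pt => (0 : Arr2)) x = 0 := by
      funext k i j
      simp [partials, pd]
    rw [this]
    rfl
  simp [flux, christoffelVar, h1]

theorem equationsOfMotion_iff (M : Set Pt) (g : Field2) (Λ v' w : ℝ) : EquationsOfMotion Λ v' w M g ↔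
    ∀ x ∈ M, ∀ i j, eulerLagrange Λ (v' + w) g i j x = 0 := by
  simp only [EquationsOfMotion, eulerLagrange, sub_eq_zero]

namespace IsAdmissible

variable {M : Set Pt} {g : Field2} (hg : IsAdmissible M g)
include hg

theorem differentiableAt {x : Pt} (hx : x ∈ M) (i j : Fin 4) :
    DifferentiableAt ℝ (fun y => g y i j) x :=
  (hg.contDiffAt x hx i j).differentiableAt (by norm_num)

theorem continuousAt_torsionCov {x : Pt} (hx : x ∈ M) (i j k : Fin 4) :
    ContinuousAt (torsionCov g i j k) x := by
  have h1 : ∀ a b c, ContinuousAt (pd c fun y => g y a b - g y b a) x := fun a b c =>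
    (contDiffAt_pd (m := 0) ((hg.contDiffAt x hx a b).sub (hg.contDiffAt x hx b a))
      (by norm_num) c).continuousAt
  refine ContinuousAt.congr (f := fun y => 1 / 2 * (pd k (fun y => g y j i - g y i j) y
      - pd i (fun y => g y j k - g y k j) y + pd j (fun y => g y i k - g y k i) y)) ?_ ?_
  · exact continuousAt_const.mul (((h1 _ _ _).sub (h1 _ _ _)).add (h1 _ _ _))
  · filter_upwards [hg.isOpen.mem_nhds hx] with y hy
    exact (torsionCov_eq (hg.nondeg y hy) (hg.differentiableAt hy) i j k).symm

theorem continuousAt_contra {x : Pt} (hx : x ∈ M) (i j : Fin 4) :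
    ContinuousAt (fun y => contra g y i j) x :=
  (contDiffAt_pi.1 (contDiffAt_pi.1 (hg.contDiffAt_contra x hx) i) j).continuousAt

theorem continuousAt_symPart {x : Pt} (hx : x ∈ M) (i j : Fin 4) :
    ContinuousAt (fun y => symPart g y i j) x := by
  have h := ((hg.contDiffAt x hx i j).continuousAt.add
    (hg.contDiffAt x hx j i).continuousAt).const_smul (1 / 2 : ℝ)
  exact h

theorem continuousAt_ricci {x : Pt} (hx : x ∈ M) (i j : Fin 4) :
    ContinuousAt (ricci g i j) x := by
  refine ContinuousAt.congr (f := fun y => jetRicci i j (jet₂ (contraArr g) y)) ?_ ?_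
  · exact ContinuousAt.comp (g := jetRicci i j)
      (contDiffAt_jetRicci (p := jet₂ (contraArr g) x) (hg.nondeg x hx) i j).continuousAt
      (continuousAt_jet₂ (hg.contDiffAt_contra x hx))
  · filter_upwards [hg.isOpen.mem_nhds hx] with y hy
    exact (ricci_eq_jet (hg.contDiffAt_contra y hy) (hg.nondeg y hy) i j).symm

theorem continuousAt_torsionArr {x : Pt} (hx : x ∈ M) : ContinuousAt (torsionArr g) x :=
  continuousAt_pi.2 fun i => continuousAt_pi.2 fun j => continuousAt_pi.2 fun k =>
    hg.continuousAt_torsionCov hx i j k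

/-- This form is free of variational derivatives, so symmetry and continuity can be read off. -/
theorem eulerLagrange_eq (Λ κ : ℝ) {x : Pt} (hx : x ∈ M) (i j : Fin 4) :
    eulerLagrange Λ κ g i j x
      = ricci g i j x - 1 / 2 * scalarCurv g x * symPart g x i j + Λ * symPart g x i j
        - κ * (3 * tripleForm (torsionArr g x) (fun c d => symUnit i j c d) (contraArr g x)
          (contraArr g x) - 1 / 2 * torsionSq g x * symPart g x i j) := by
  rw [eulerLagrange, calW_eq_zero (hg.contDiffAt_contra x hx) (hg.nondeg x hx)
    (hg.differentiableAt hx), tau_eq (hg.nondeg x hx)]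
  simp only [mul_zero, add_zero]
  rfl

theorem eulerLagrange_comm (Λ κ : ℝ) {x : Pt} (hx : x ∈ M) (i j : Fin 4) :
    eulerLagrange Λ κ g i j x = eulerLagrange Λ κ g j i x := by
  rw [hg.eulerLagrange_eq Λ κ hx, hg.eulerLagrange_eq Λ κ hx, hg.ricci_symm x hx i j,
    symPart_comm g x i j, symUnit_comm i j]

theorem continuousOn_eulerLagrange (Λ κ : ℝ) (i j : Fin 4) :
    ContinuousOn (eulerLagrange Λ κ g i j) M := by
  refine ContinuousOn.congr (f := fun x => ricci g i j x
      - 1 / 2 * scalarCurv g x * symPart g x i j + Λ * symPart g x i j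
        - κ * (3 * tripleForm (torsionArr g x) (fun c d => symUnit i j c d) (contraArr g x)
          (contraArr g x) - 1 / 2 * torsionSq g x * symPart g x i j)) ?_
    fun x hx => hg.eulerLagrange_eq Λ κ hx i j
  intro x hx
  refine ContinuousAt.continuousWithinAt ?_
  have h1 := hg.continuousAt_ricci hx
  have h2 := hg.continuousAt_contra hx
  have h3 := hg.continuousAt_symPart hx i j
  have h4 := hg.continuousAt_torsionCov hx
  have h5 : ContinuousAt (scalarCurv g) x :=
    tendsto_finsetSum _ fun a _ => tendsto_finsetSum _ fun b _ => (h2 a b).mul (h1 a b)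
  have h6 : ContinuousAt (torsionSq g) x :=
    tendsto_finsetSum _ fun c _ => tendsto_finsetSum _ fun d _ =>
    tendsto_finsetSum _ fun e _ => tendsto_finsetSum _ fun a _ =>
    tendsto_finsetSum _ fun b _ => tendsto_finsetSum _ fun z _ =>
    ((((h2 c d).mul (h2 e a)).mul (h2 b z)).mul (h4 e c b)).mul (h4 a d z)
  have h7 : ContinuousAt (fun x => tripleForm (torsionArr g x) (fun c d => symUnit i j c d)
      (contraArr g x) (contraArr g x)) x :=
    tendsto_finsetSum _ fun c _ => tendsto_finsetSum _ fun d _ =>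
    tendsto_finsetSum _ fun e _ => tendsto_finsetSum _ fun a _ =>
    tendsto_finsetSum _ fun b _ => tendsto_finsetSum _ fun z _ =>
    (((continuousAt_const.mul (h2 e a)).mul (h2 b z)).mul (h4 e c b)).mul (h4 a d z)
  exact (((h1 i j).sub ((continuousAt_const.mul h5).mul h3)).add (continuousAt_const.mul h3)).sub
    (continuousAt_const.mul ((continuousAt_const.mul h7).sub
      ((continuousAt_const.mul h6).mul h3)))

theorem continuousOn_volDensity : ContinuousOn (volDensity g) M := fun x hx =>
  (contDiffAt_volDensity (hg.contDiffAt_contra x hx)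
    (hg.nondeg x hx)).continuousAt.continuousWithinAt

theorem volDensity_ne_zero {x : Pt} (hx : x ∈ M) : volDensity g x ≠ 0 :=
  (Real.sqrt_pos.2 (abs_pos.2 (det_symPart_ne_zero (hg.nondeg x hx)))).ne'

theorem integral_div_flux {h : Field2} {K : Set Pt} (hK : IsCompact K) (hKM : K ⊆ M)
    (hh : ContDiff ℝ 2 (toArr h)) (hsupp : tsupport h ⊆ K) (k : Fin 4) :
    ∫ x in K, pd k (flux g h k) x = 0 := by
  have hts : tsupport (flux g h k) ⊆ tsupport h :=
    closure_minimal (fun x hx => by_contra fun hx' => hx (flux_eq_zero hx' k))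
      (isClosed_tsupport h)
  have hC : ContDiff ℝ 1 (flux g h k) := contDiff_iff_contDiffAt.2 fun x => by
    by_cases hx : x ∈ tsupport h
    · have hxM := hKM (hsupp hx)
      exact contDiffAt_flux (hg.contDiffAt_contra x hxM) (hg.nondeg x hxM) hh.contDiffAt k
    · have h0 : flux g h k =ᶠ[𝓝 x] fun _ => 0 := by
        filter_upwards [(isClosed_tsupport h).isOpen_compl.mem_nhds hx] with y hy
        exact flux_eq_zero hy k
      exact contDiffAt_const.congr_of_eventuallyEq h0
  rw [setIntegral_eq_integral_of_forall_compl_eq_zero]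
  · exact integral_pd_eq_zero hC (HasCompactSupport.of_support_subset_isCompact hK
      ((subset_tsupport _).trans (hts.trans hsupp))) k
  · intro x hx
    have : fderiv ℝ (flux g h k) x = 0 := image_eq_zero_of_notMem_tsupport fun hx' =>
      hx (hsupp (hts (tsupport_fderiv_subset ℝ hx')))
    rw [pd, this]
    rfl

theorem hasDerivAt_action (Λ v' w : ℝ) {h : Field2} {K : Set Pt} (hK : IsCompact K)
    (hKM : K ⊆ M) (hh : ContDiff ℝ 2 (toArr h)) (hs : ∀ x, (h x).IsSymm)
    (hsupp : tsupport h ⊆ K) :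
    HasDerivAt (fun ε : ℝ => action Λ v' w K (vary g h ε))
      (∫ x in K, volDensity g x * ∑ i, ∑ j, eulerLagrange Λ (v' + w) g i j x * h x i j) 0 := by
  have hO : IsOpen {p : (Arr2 × Arr3 × Arr4) × Arr3 | p.1.1 ∈ GenRiem.nondeg} :=
    isOpen_nondeg.preimage (by fun_prop)
  have hy : ∀ x ∈ K, ContinuousAt (fun x => (jet₂ (contraArr g) x, torsionArr g x)) x :=
    fun x hx => (continuousAt_jet₂ (hg.contDiffAt_contra x (hKM hx))).prodMk
      (hg.continuousAt_torsionArr (hKM hx))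
  have hz : ∀ x ∈ K, ContinuousAt (fun x => (jet₂ (toArr h) x, (0 : Arr3))) x :=
    fun x hx => (continuousAt_jet₂ hh.contDiffAt).prodMk continuousAt_const
  have hD := hasDerivAt_setIntegral_line (μ := volume) hO (Ψ := jetLagrangian Λ (v' + w))
    (fun p hp => ((contDiffAt_jetLagrangian Λ (v' + w) hp).of_le (by simp)).contDiffWithinAt)
    hK hy hz (fun x hx => hg.nondeg x (hKM hx))
  have hev : (fun ε : ℝ => action Λ v' w K (vary g h ε)) =ᶠ[𝓝 0] fun ε => ∫ x in K,
      jetLagrangian Λ (v' + w) ((jet₂ (contraArr g) x, torsionArr g x)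
        + ε • (jet₂ (toArr h) x, (0 : Arr3))) := by
    -- For small `ε` the varied metric is nondegenerate on all of `K` at once, so its integrand is
    -- given by the jet formula.
    filter_upwards [eventually_line_mem isOpen_nondeg hK (y := contraArr g) (z := toArr h)
      (fun x hx => (hg.contDiffAt_contra x (hKM hx)).continuousAt)
      (fun x hx => hh.continuous.continuousAt) (fun x hx => hg.nondeg x (hKM hx))] with ε hε
    refine setIntegral_congr_fun hK.measurableSet fun x hx => ?_
    exact lagrangian_vary_eq_jet hs (hg.contDiffAt_contra x (hKM hx)) hh.contDiffAt (hε x hx)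
      Λ v' w (hg.nondeg x (hKM hx)) (hg.differentiableAt (hKM hx))
  refine (hD.congr_of_eventuallyEq hev).congr_deriv ?_
  have hh' : ∀ i j, Continuous fun x => h x i j := fun i j =>
    (contDiff_pi.1 (contDiff_pi.1 hh i) j).continuous
  have i1 : IntegrableOn (fun x => volDensity g x * ∑ i, ∑ j,
      eulerLagrange Λ (v' + w) g i j x * h x i j) K := by
    refine ContinuousOn.integrableOn_compact hK ?_
    exact (hg.continuousOn_volDensity.mono hKM).mul (continuousOn_finsetSum _ fun i _ =>
      continuousOn_finsetSum _ fun j _ =>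
        ((hg.continuousOn_eulerLagrange Λ (v' + w) i j).mono hKM).mul (hh' i j).continuousOn)
  have i2 : ∀ k ∈ Finset.univ, IntegrableOn (pd k (flux g h k)) K := fun k _ =>
    ContinuousOn.integrableOn_compact hK fun x hx => (contDiffAt_pd (m := 0)
      (contDiffAt_flux (hg.contDiffAt_contra x (hKM hx)) (hg.nondeg x (hKM hx)) hh.contDiffAt k)
      (by norm_num) k).continuousAt.continuousWithinAt
  rw [setIntegral_congr_fun hK.measurableSet fun x hx =>
    fderiv_jetLagrangian Λ (v' + w) (hg.contDiffAt_contra x (hKM hx)) (hg.nondeg x (hKM hx))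
      (hg.differentiableAt (hKM hx)) (hs x) hh.contDiffAt (hg.compatible x (hKM hx)),
    integral_add i1 (integrable_finsetSum _ i2), integral_finsetSum _ i2,
    Finset.sum_eq_zero fun k _ => hg.integral_div_flux hK hKM hh hsupp k, add_zero]

/-- The equations of motion are the Euler-Lagrange equations of the action. -/
theorem isStationary_iff (Λ v' w : ℝ) :
    IsStationary Λ v' w M g ↔ EquationsOfMotion Λ v' w M g := by
  rw [equationsOfMotion_iff]
  have hsmooth : ∀ h : Field2, (∀ i j, ContDiff ℝ ∞ fun x => h x i j) →
      ContDiff ℝ 2 (toArr h) := fun h hh =>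
    contDiff_pi.2 fun i => contDiff_pi.2 fun j => (hh i j).of_le two_le_infty
  constructor
  · intro H x hx i j
    have hcont : ContinuousOn (fun x => volDensity g x * eulerLagrange Λ (v' + w) g i j x) M :=
      hg.continuousOn_volDensity.mul (hg.continuousOn_eulerLagrange Λ (v' + w) i j)
    -- The test variation is a bump function times `symUnit i j`. It detects the average of the `(i,
    -- j)` and `(j, i)` components, which is the component itself by `eulerLagrange_comm`.
    have hae := hg.isOpen.ae_eq_zero_of_integral_contDiff_smul_eq_zero (μ := volume)
      (hcont.locallyIntegrableOn hg.isOpen.measurableSet) (fun φ hφ hφc hφM => by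
        set h : Field2 := fun x => φ x • symUnit i j with hh
        have hs : ∀ x, (h x).IsSymm := fun x => (symUnit_isSymm i j).smul _
        have hhs : ∀ a b, ContDiff ℝ ∞ fun x => h x a b := fun a b =>
          hφ.mul contDiff_const
        have hsupp : tsupport h ⊆ tsupport φ := tsupport_smul_subset_left φ _
        have hD := hg.hasDerivAt_action Λ v' w hφc.isCompact hφM (hsmooth h hhs) hs hsupp
        have h0 := hD.unique (H (tsupport φ) hφc.isCompact hφM h hhs hs hsupp)
        rw [← setIntegral_eq_integral_of_forall_compl_eq_zero (s := tsupport φ)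
          fun x hx => by rw [image_eq_zero_of_notMem_tsupport hx, zero_smul], ← h0]
        refine setIntegral_congr_fun hφc.isCompact.measurableSet fun x hx => ?_
        have e : ∑ a, ∑ b, eulerLagrange Λ (v' + w) g a b x * h x a b
            = φ x * eulerLagrange Λ (v' + w) g i j x := by
          have := hg.eulerLagrange_comm Λ (v' + w) (hφM hx) j i
          simp [hh, symUnit, Matrix.single_apply, mul_add, Finset.sum_add_distrib, ite_and, this]
          ring
        simp only [e, smul_eq_mul]
        ring)
    -- Continuity upgrades vanishing almost everywhere to vanishing at each point.
    have hzero := Measure.eqOn_open_of_ae_eq (g := fun _ => (0 : ℝ))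
      ((ae_restrict_iff' hg.isOpen.measurableSet).2 hae) hg.isOpen hcont continuousOn_const hx
    exact (mul_eq_zero.1 hzero).resolve_left (hg.volDensity_ne_zero hx)
  · intro H K hK hKM h hh hs hsupp
    refine (hg.hasDerivAt_action Λ v' w hK hKM (hsmooth h hh) hs hsupp).congr_deriv ?_
    rw [setIntegral_congr_fun (g := fun _ => (0 : ℝ)) hK.measurableSet fun x hx => by
      simp [H x (hKM hx)]]
    simp

end IsAdmissible

/-! ### The metric with diagonal symmetric part depending on `t`. -/

section Example

variable {J : Set ℝ} {s : Fin 4 → ℝ → ℝ} {n : Fin 6 → ℝ → ℝ} {x : Pt}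

theorem symPart_exMetric (s : Fin 4 → ℝ → ℝ) (n : Fin 6 → ℝ → ℝ) (x : Pt) :
    symPart (exMetric s n) x = Matrix.diagonal fun i => s i (x 0) := by
  ext i j
  fin_cases i <;> fin_cases j <;> simp [symPart, exMetric] <;> ring

theorem contra_exMetric (h0 : ∀ i, s i (x 0) ≠ 0) :
    contra (exMetric s n) x = Matrix.diagonal fun i => (s i (x 0))⁻¹ := by
  rw [contra, symPart_exMetric]
  refine Matrix.inv_eq_right_inv ?_
  rw [Matrix.diagonal_mul_diagonal, ← Matrix.diagonal_one]
  congr 1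
  funext i
  exact mul_inv_cancel₀ (h0 i)

theorem exMetric_nondeg (h0 : ∀ i, s i (x 0) ≠ 0) : contraArr (exMetric s n) x ∈ nondeg := by
  refine contraArr_mem_nondeg ?_
  rw [symPart_exMetric, Matrix.det_diagonal]
  exact Finset.prod_ne_zero_iff.2 fun i _ => h0 i

theorem eventually_time_mem (hJ : IsOpen J) (hx : x 0 ∈ J) : ∀ᶠ y : Pt in 𝓝 x, y 0 ∈ J :=
  (continuous_apply 0).continuousAt.eventually (hJ.mem_nhds hx)

theorem contDiffAt_comp_time {f : ℝ → ℝ} {m : ℕ∞ω} (hJ : IsOpen J) (hf : ContDiffOn ℝ m f J)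
    (hx : x 0 ∈ J) : ContDiffAt ℝ m (fun y : Pt => f (y 0)) x :=
  (hf.contDiffAt (hJ.mem_nhds hx)).comp x (contDiff_apply ℝ ℝ (0 : Fin 4)).contDiffAt

theorem contDiffAt_contraArr_exMetric (hJ : IsOpen J) (hs : ∀ i, ContDiffOn ℝ 2 (s i) J)
    (hs0 : ∀ i, ∀ t ∈ J, s i t ≠ 0) (hx : x 0 ∈ J) :
    ContDiffAt ℝ 2 (contraArr (exMetric s n)) x := by
  refine contDiffAt_pi.2 fun i => contDiffAt_pi.2 fun j => ?_
  have e : (fun y => contraArr (exMetric s n) y i j) =ᶠ[𝓝 x]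
      fun y => if i = j then (s i (y 0))⁻¹ else 0 := by
    filter_upwards [eventually_time_mem hJ hx] with y hy
    rw [contraArr, contra_exMetric fun i => hs0 i _ hy, Matrix.diagonal_apply]
  refine ContDiffAt.congr_of_eventuallyEq ?_ e
  split_ifs
  · exact (contDiffAt_comp_time hJ (hs i) hx).inv (hs0 i _ hx)
  · exact contDiffAt_const

theorem contDiffAt_exMetric (hJ : IsOpen J) (hs : ∀ i, ContDiffOn ℝ 2 (s i) J)
    (hn : ∀ k, ContDiffOn ℝ 1 (n k) J) (hx : x 0 ∈ J) (i j : Fin 4) :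
    ContDiffAt ℝ 1 (fun y => exMetric s n y i j) x := by
  have h1 := fun i => contDiffAt_comp_time hJ ((hs i).of_le (by norm_num : (1 : ℕ∞ω) ≤ 2)) hx
  have h2 := fun i => contDiffAt_comp_time hJ (hn i) hx
  have h3 := fun i => (h2 i).neg
  fin_cases i <;> fin_cases j <;> first | exact h1 _ | exact h2 _ | exact h3 _

/-- Time derivatives of the anti-symmetric entries. -/
def antiDeriv (n : Fin 6 → ℝ → ℝ) (t : ℝ) : Matrix (Fin 4) (Fin 4) ℝ :=
  !![0, deriv (n 0) t, deriv (n 1) t, deriv (n 2) t;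
     -deriv (n 0) t, 0, deriv (n 3) t, deriv (n 4) t;
     -deriv (n 1) t, -deriv (n 3) t, 0, deriv (n 5) t;
     -deriv (n 2) t, -deriv (n 4) t, -deriv (n 5) t, 0]

theorem pd_exMetric_sub (hJ : IsOpen J) (hn : ∀ k, ContDiffOn ℝ 1 (n k) J) (hx : x 0 ∈ J)
    (i j k : Fin 4) : pd k (fun y => exMetric s n y i j - exMetric s n y j i) x
      = if k = 0 then 2 * antiDeriv n (x 0) i j else 0 := by
  have h : ∀ m, HasDerivAt (n m) (deriv (n m) (x 0)) (x 0) := fun m =>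
    (((hn m).contDiffAt (hJ.mem_nhds hx)).differentiableAt (by norm_num)).hasDerivAt
  -- The metric depends on `x 0` only, so it may be evaluated at constant points `fun _ => t`.
  have h0 : HasDerivAt (fun t => exMetric s n (fun _ => t) i j - exMetric s n (fun _ => t) j i)
      (2 * antiDeriv n (x 0) i j) (x 0) := by
    have h1 : (fun t => exMetric s n (fun _ => t) i j - exMetric s n (fun _ => t) j i)
        = fun t => 2 * !![0, n 0 t, n 1 t, n 2 t; -n 0 t, 0, n 3 t, n 4 t;
          -n 1 t, -n 3 t, 0, n 5 t; -n 2 t, -n 4 t, -n 5 t, 0] i j := by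
      funext t
      fin_cases i <;> fin_cases j <;> simp [exMetric] <;> ring
    rw [h1]
    refine HasDerivAt.const_mul 2 ?_
    fin_cases i <;> fin_cases j <;>
      first | exact hasDerivAt_const _ _ | exact h _ | exact (h _).neg
  exact pd_comp_time h0 k

/-- The squared norm of the torsion of the metric. -/
theorem torsionSq_exMetric (hJ : IsOpen J) (hs : ∀ i, ContDiffOn ℝ 2 (s i) J)
    (hn : ∀ k, ContDiffOn ℝ 1 (n k) J) (hs0 : ∀ i, ∀ t ∈ J, s i t ≠ 0) (hx : x 0 ∈ J) :
    torsionSq (exMetric s n) x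
      = 6 * (s 0 (x 0) * s 1 (x 0) * s 2 (x 0) * s 3 (x 0))⁻¹ *
          (s 3 (x 0) * deriv (n 3) (x 0) ^ 2 + s 2 (x 0) * deriv (n 4) (x 0) ^ 2
            + s 1 (x 0) * deriv (n 5) (x 0) ^ 2) := by
  have h0 : ∀ i, s i (x 0) ≠ 0 := fun i => hs0 i _ hx
  -- Only time derivatives survive, and by antisymmetry a nonzero component has exactly one index
  -- `0`. So `n 0`, `n 1`, `n 2` drop out, and each of the pairs `(1,2)`, `(1,3)`, `(2,3)` occurs in
  -- six orderings with `0`: the factor `6`.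
  have hT : ∀ i j k, torsionCov (exMetric s n) i j k x
      = (if k = 0 then antiDeriv n (x 0) j i else 0) - (if i = 0 then antiDeriv n (x 0) j k else 0)
        + (if j = 0 then antiDeriv n (x 0) i k else 0) := by
    intro i j k
    rw [torsionCov_eq (exMetric_nondeg h0) fun i j =>
      (contDiffAt_exMetric hJ hs hn hx i j).differentiableAt (by norm_num)]
    simp only [pd_exMetric_sub hJ hn hx]
    split_ifs <;> ring
  have e : torsionSq (exMetric s n) x = ∑ c, ∑ e, ∑ b, (s c (x 0))⁻¹ * (s e (x 0))⁻¹
      * (s b (x 0))⁻¹ * torsionCov (exMetric s n) e c b x ^ 2 := by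
    simp only [torsionSq, contra_exMetric h0, Matrix.diagonal_apply, ite_mul, zero_mul, mul_ite,
      mul_zero, Finset.sum_ite_eq, Finset.mem_univ, if_true, Finset.sum_const_zero, pow_two,
      mul_assoc, Finset.sum_ite_irrel]
  have h1 := h0 0
  have h2 := h0 1
  have h3 := h0 2
  have h4 := h0 3
  rw [e]
  simp only [hT, Fin.sum_univ_four]
  simp [antiDeriv]
  field_simp
  ring

theorem pd_symPart_exMetric (hJ : IsOpen J) (hs : ∀ i, ContDiffOn ℝ 2 (s i) J) (hx : x 0 ∈ J)
    (i j k : Fin 4) : pd k (fun y => symPart (exMetric s n) y i j) x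
      = if k = 0 then if i = j then deriv (s i) (x 0) else 0 else 0 := by
  simp only [symPart_exMetric, Matrix.diagonal_apply]
  refine pd_comp_time (f := fun t => if i = j then s i t else 0) ?_ k
  split_ifs
  · exact (((hs i).contDiffAt (hJ.mem_nhds hx)).differentiableAt (by norm_num)).hasDerivAt
  · exact hasDerivAt_const _ _

theorem christoffel_exMetric (hJ : IsOpen J) (hs : ∀ i, ContDiffOn ℝ 2 (s i) J)
    (hs0 : ∀ i, ∀ t ∈ J, s i t ≠ 0) (hx : x 0 ∈ J) (i j k : Fin 4) :
    christoffel (exMetric s n) i j k x = 1 / 2 * (s i (x 0))⁻¹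
      * ((if k = 0 then if j = i then deriv (s j) (x 0) else 0 else 0)
        - (if i = 0 then if j = k then deriv (s j) (x 0) else 0 else 0)
        + (if j = 0 then if i = k then deriv (s i) (x 0) else 0 else 0)) := by
  simp only [christoffel, contra_exMetric fun i => hs0 i _ hx, Matrix.diagonal_apply, ite_mul,
    zero_mul, Finset.sum_ite_eq, Finset.mem_univ, if_true, pd_symPart_exMetric hJ hs hx]
  ring

/-- Both sides vanish off the diagonal and for `k ≠ 0`. For `k = 0` and `i = j` this is the
logarithmic derivative of `√|g| / s i`. -/
theorem isCompatible_exMetric (hJ : IsOpen J) (hs : ∀ i, ContDiffOn ℝ 2 (s i) J)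
    (hs0 : ∀ i, ∀ t ∈ J, s i t ≠ 0) (hx : x 0 ∈ J) : IsCompatible (exMetric s n) x := by
  have h0 : ∀ i, s i (x 0) ≠ 0 := fun i => hs0 i _ hx
  have hd : ∀ i, HasDerivAt (s i) (deriv (s i) (x 0)) (x 0) := fun i =>
    (((hs i).contDiffAt (hJ.mem_nhds hx)).differentiableAt (by norm_num)).hasDerivAt
  have hvol : ∀ y, volDensity (exMetric s n) y
      = √|s 0 (y 0) * s 1 (y 0) * s 2 (y 0) * s 3 (y 0)| := fun y => by
    rw [volDensity, symPart_exMetric, Matrix.det_diagonal, Fin.prod_univ_four]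
  have hp : s 0 (x 0) * s 1 (x 0) * s 2 (x 0) * s 3 (x 0) ≠ 0 :=
    mul_ne_zero (mul_ne_zero (mul_ne_zero (h0 0) (h0 1)) (h0 2)) (h0 3)
  have hvd : HasDerivAt (fun t => √|s 0 t * s 1 t * s 2 t * s 3 t|)
      (1 / 2 * volDensity (exMetric s n) x * ∑ b, deriv (s b) (x 0) / s b (x 0)) (x 0) := by
    have h := (hasDerivAt_sqrt_abs hp).comp (x 0)
      ((((hd 0).fun_mul (hd 1)).fun_mul (hd 2)).fun_mul (hd 3))
    refine h.congr_deriv ?_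
    have h1 := h0 0
    have h2 := h0 1
    have h3 := h0 2
    have h4 := h0 3
    rw [hvol, Fin.sum_univ_four]
    field_simp
  intro k i j
  have e : (fun y => volDensity (exMetric s n) y * contra (exMetric s n) y i j) =ᶠ[𝓝 x]
      fun y => if i = j then √|s 0 (y 0) * s 1 (y 0) * s 2 (y 0) * s 3 (y 0)| * (s i (y 0))⁻¹
        else 0 := by
    filter_upwards [eventually_time_mem hJ hx] with y hy
    rw [contra_exMetric fun i => hs0 i _ hy, Matrix.diagonal_apply, hvol, mul_ite, mul_zero]
  have hder : HasDerivAt (fun t => if i = j then √|s 0 t * s 1 t * s 2 t * s 3 t| * (s i t)⁻¹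
      else 0) (if i = j then volDensity (exMetric s n) x * (s i (x 0))⁻¹
        * (1 / 2 * (∑ b, deriv (s b) (x 0) / s b (x 0)) - deriv (s i) (x 0) / s i (x 0)) else 0)
      (x 0) := by
    split_ifs
    · refine (hvd.fun_mul ((hd i).fun_inv (h0 i))).congr_deriv ?_
      have := h0 i
      rw [← hvol]
      field_simp
      ring
    · exact hasDerivAt_const _ _
  rw [pd_congr e, pd_comp_time hder k]
  simp only [contra_exMetric h0, Matrix.diagonal_apply, ite_mul, zero_mul, Finset.sum_ite_eq,
    Finset.sum_ite_eq', Finset.mem_univ, if_true, christoffel_exMetric hJ hs hs0 hx]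
  -- The trace `Γ^b_{kb}` is the logarithmic derivative of the volume density.
  have htr : ∑ b, 1 / 2 * (s b (x 0))⁻¹
      * ((if b = 0 then if k = b then deriv (s k) (x 0) else 0 else 0)
        - (if b = 0 then if k = b then deriv (s k) (x 0) else 0 else 0)
        + (if k = 0 then deriv (s b) (x 0) else 0))
      = if k = 0 then 1 / 2 * ∑ b, deriv (s b) (x 0) / s b (x 0) else 0 := by
    split_ifs with hk
    · rw [Finset.mul_sum]
      refine Finset.sum_congr rfl fun b _ => ?_
      simp
      ring
    · simp
  rw [htr]
  generalize (∑ b, deriv (s b) (x 0) / s b (x 0)) = D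
  generalize volDensity (exMetric s n) x = V
  have hi := h0 i
  by_cases hij : i = j
  · subst hij
    by_cases hk : k = 0
    · subst hk
      by_cases hi0 : i = 0
      · subst hi0; simp; field_simp; ring
      · simp [hi0]; field_simp; ring
    · by_cases hki : k = i
      · subst hki; simp [hk]
      · simp [hk, Ne.symm hki]
  · simp only [hij, Ne.symm hij, if_false, ite_self]
    ring

/-- The only term not symmetric by relabelling is `∂_j Γ^a_{ia}`. Here `Γ^a_{ia}` depends on `t` and
vanishes unless `i = 0`, so that term lives at `i = j = 0`. -/
theorem ricci_exMetric_comm (hJ : IsOpen J) (hs : ∀ i, ContDiffOn ℝ 2 (s i) J)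
    (hs0 : ∀ i, ∀ t ∈ J, s i t ≠ 0) (hx : x 0 ∈ J) (i j : Fin 4) :
    ricci (exMetric s n) i j x = ricci (exMetric s n) j i x := by
  have hpd : ∀ a i j, pd j (christoffel (exMetric s n) a i a) x
      = if j = 0 then if i = 0 then
          deriv (fun t => 1 / 2 * (s a t)⁻¹ * deriv (s a) t) (x 0) else 0 else 0 := by
    intro a i j
    have e : christoffel (exMetric s n) a i a =ᶠ[𝓝 x]
        fun y => if i = 0 then 1 / 2 * (s a (y 0))⁻¹ * deriv (s a) (y 0) else 0 := by
      filter_upwards [eventually_time_mem hJ hx] with y hy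
      rw [christoffel_exMetric hJ hs hs0 hy]
      by_cases hi : i = 0 <;> by_cases ha : a = 0 <;> by_cases hia : i = a <;> simp_all
    have hd : HasDerivAt (fun t => 1 / 2 * (s a t)⁻¹ * deriv (s a) t)
        (deriv (fun t => 1 / 2 * (s a t)⁻¹ * deriv (s a) t) (x 0)) (x 0) := by
      have h1 := (hs a).contDiffAt (hJ.mem_nhds hx)
      have h2 : DifferentiableAt ℝ (deriv (s a)) (x 0) :=
        (((hs a).deriv_of_isOpen hJ (m := 1) (by norm_num)).contDiffAt
          (hJ.mem_nhds hx)).differentiableAt (by norm_num)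
      exact (((h1.differentiableAt (by norm_num)).inv (hs0 a _ hx)).const_mul _ |>.mul
        h2).hasDerivAt
    rw [pd_congr e, pd_comp_time (f := fun t => if i = 0 then
      1 / 2 * (s a t)⁻¹ * deriv (s a) t else 0) (f' := if i = 0 then
          deriv (fun t => 1 / 2 * (s a t)⁻¹ * deriv (s a) t) (x 0) else 0) ?_ j]
    split_ifs
    · exact hd
    · exact hasDerivAt_const _ _
  have h4 : ∑ a, ∑ b, christoffel (exMetric s n) b i a x * christoffel (exMetric s n) a b j x
      = ∑ a, ∑ b, christoffel (exMetric s n) b j a x * christoffel (exMetric s n) a b i x := by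
    rw [Finset.sum_comm]
    refine Finset.sum_congr rfl fun a _ => Finset.sum_congr rfl fun b _ => ?_
    rw [christoffel_comm _ a i b, christoffel_comm _ b a j, mul_comm]
  simp only [ricci, riemann, Finset.sum_sub_distrib, Finset.sum_add_distrib, h4, hpd,
    christoffel_comm _ _ i j]
  by_cases hi : i = 0 <;> by_cases hj : j = 0 <;> simp [hi, hj]

theorem isAdmissible_exMetric (hJ : IsOpen J) (hs : ∀ i, ContDiffOn ℝ 2 (s i) J)
    (hn : ∀ k, ContDiffOn ℝ 1 (n k) J) (hs0 : ∀ i, ∀ t ∈ J, s i t ≠ 0) :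
    IsAdmissible {x | x 0 ∈ J} (exMetric s n) where
  isOpen := hJ.preimage (continuous_apply 0)
  contDiffAt_contra _ hx := contDiffAt_contraArr_exMetric hJ hs hs0 hx
  nondeg _ hx := exMetric_nondeg fun i => hs0 i _ hx
  contDiffAt _ hx := contDiffAt_exMetric hJ hs hn hx
  compatible _ hx := isCompatible_exMetric hJ hs hs0 hx
  ricci_symm _ hx := ricci_exMetric_comm hJ hs hs0 hx

end Example

end GenRiem

end

theorem mainTheorem4 (J : Set ℝ) (hJ : IsOpen J)
    (s : Fin 4 → ℝ → ℝ) (n : Fin 6 → ℝ → ℝ)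
    (hs : ∀ i, ContDiffOn ℝ 2 (s i) J) (hn : ∀ k, ContDiffOn ℝ 1 (n k) J)
    (hs0 : ∀ i, ∀ t ∈ J, s i t ≠ 0) (Λ v' w : ℝ) :
    (∀ x : GenRiem.Pt, x 0 ∈ J →
      GenRiem.matterL v' w (GenRiem.exMetric s n) x =
        -6 * (v' + w) * (s 0 (x 0) * s 1 (x 0) * s 2 (x 0) * s 3 (x 0))⁻¹ *
          (s 3 (x 0) * deriv (n 3) (x 0) ^ 2 + s 2 (x 0) * deriv (n 4) (x 0) ^ 2
            + s 1 (x 0) * deriv (n 5) (x 0) ^ 2)) ∧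
    (GenRiem.IsStationary Λ v' w {x | x 0 ∈ J} (GenRiem.exMetric s n) ↔
      GenRiem.EquationsOfMotion Λ v' w {x | x 0 ∈ J} (GenRiem.exMetric s n)) := by
  refine ⟨fun x hx => ?_, (GenRiem.isAdmissible_exMetric hJ hs hn hs0).isStationary_iff Λ v' w⟩
  rw [GenRiem.matterL, GenRiem.torsionSq_exMetric hJ hs hn hs0 hx]
  ring
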